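/- Let $n\ge 0$ and let $\epsilon_1,\dots,\epsilon_n$ be the standard basis of $\mathbf Z^n$. Put $\Phi^+=\{\epsilon_i-\epsilon_j \mid 1\le i<j\le n\}$. A word $u_1\cdots u_N$ is a hook word if $u_1\ge\cdots\ge u_k<u_{k+1}<\cdots<u_N$ for some $1\le k\le N$. A semistandard decomposition tableau $T$ (for $\mathfrak q(n)$) is a filling of a shifted diagram, whose row lengths form a strict partition with at most $n$ parts, by letters $1,\dots,n$ such that every row (read from left to right) is a hook word and, for any two successive rows, the upper row $v$ is a hook subword of maximal length in the concatenation $v'v$ of the lower row $v'$ with $v$. Such a $T$ is dual marginally large if it has exactly $n$ rows and, for every $1\le i\le n$, the number of leftmost $i$-boxes (the length of the initial run of $i$'s) in the $i$-th row from the bottom exceeds the number of boxes of the row directly below it (zero if $i=1$) by exactly one. Let $\mathrm{SDT}(-\infty)$ be the set of dual marginally large tableaux. The weight of $T\in\mathrm{SDT}(-\infty)$ is $\mathrm{wt}(T)=\sum_{\text{boxes}}(\epsilon_{a}-\epsilon_{r})$, where $a$ is the entry of the box and $r$ is the number of its row counted from the bottom. Let $\mathrm{rd}(T)$ be the word obtained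 by reading the rows from top to bottom, each from right to left, and, for $1\le i\le n-1$, let $\mathrm{red}_i(T)$ be what remains of the subword of letters $i,i+1$ after successively deleting adjacent pairs $(i+1)\,i$. The lowering operators are as follows. For $1\le i\le n-1$: $f_iT=\boldsymbol 0$ if $\mathrm{red}_i(T)$ contains no $i$; otherwise $f_iT$ is obtained by changing the box of the rightmost $i$ of $\mathrm{red}_i(T)$ to $i+1$ and, if the result is not dual marginally large, removing the leftmost box of each of the top $n-i$ rows (and sliding back to a shifted shape). For $n\ge2$: $f_{\overline 1}T=\boldsymbol 0$ if the leftmost letter among all $1$'s and $2$'s of $\mathrm{rd}(T)$ is a $2$; otherwise $f_{\overline 1}T$ is obtained by changing that $1$ to a $2$ and, if the result is not dual marginally large, removing the leftmost box of each of the top $n-1$ rows. An element $T$ is of lowest weight if all these operators send it to $\boldsymbol 0$. Proposition. There exists a bijection $\Xi$ from the set of subsets of $\Phi^+$ to the set of lowest weight elements of $\mathrm{SDT}(-\infty)$ that is weight preserving: for every $B\subseteq\Phi^+$, $\mathrm{wt}(\Xi(B))=\sum_{\beta\in B}\beta$. -/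

import Mathlib

namespace QueerCrystal

/-- A hook word: `u₁ ≥ u₂ ≥ ⋯ ≥ u_k < u_{k+1} < ⋯ < u_N` with `1 ≤ k ≤ N`. Here `x = u_k`. -/
def IsHookWord {α : Type*} [LinearOrder α] (u : List α) : Prop :=
  ∃ (v : List α) (x : α) (w : List α),
    u = v ++ x :: w ∧ (v ++ [x]).Pairwise (· ≥ ·) ∧ (x :: w).Pairwise (· < ·)

/-- A filling of a shifted diagram with (at most) `n` rows by letters from an `n`-letter alphabet.
The letter written `a ∈ {1, …, n}` in mathematics is the element `a - 1` of `Fin n`.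
The rows are indexed from the bottom to the top: `T j` is the word, read from left to right, of the
row which is number `n - j` from the top (`j` counted from `0`); the top row is `T (n - 1)`. -/
abbrev Filling (n : ℕ) : Type := Fin n → List (Fin n)

/-- Semistandard decomposition tableaux. In `shape` and `maximal`, row `j` is the row directly above
row `i`. -/
structure IsSDT {n : ℕ} (T : Filling n) : Prop where
  /-- The row lengths form a strict partition. -/
  shape : ∀ i j : Fin n, i.val + 1 = j.val →
    (T i).length < (T j).length ∨ (T i = [] ∧ T j = [])
  /-- Every row is a hook word. -/
  hook : ∀ i : Fin n, T i ≠ [] → IsHookWord (T i)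
  /-- The upper of two successive rows is a hook subword of maximal length in the
  concatenation of the lower row with the upper row. -/
  maximal : ∀ i j : Fin n, i.val + 1 = j.val → T i ≠ [] →
    ∀ w : List (Fin n), w.Sublist (T i ++ T j) → IsHookWord w → w.length ≤ (T j).length

/-- The number of leftmost `j`-boxes in row `j`, that is, the length of the initial run of `j`'s. -/
def leadingCount {n : ℕ} (T : Filling n) (j : Fin n) : ℕ :=
  ((T j).takeWhile (fun a => decide (a = j))).length

/-- The total number of boxes in the row directly below row `j` (`0` for the bottom row). -/
def lengthBelow {n : ℕ} (T : Filling n) (j : Fin n) : ℕ :=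
  if 0 < j.val then (T ⟨j.val - 1, lt_of_le_of_lt (Nat.sub_le _ _) j.isLt⟩).length else 0

/-- Dual marginally large: there are `n` rows, and for every `j` the number of leftmost `j`-boxes
in row `j` exceeds the total number of boxes in the row below by exactly one. -/
def IsDualMarginallyLarge {n : ℕ} (T : Filling n) : Prop :=
  (∀ j : Fin n, T j ≠ []) ∧ ∀ j : Fin n, leadingCount T j = lengthBelow T j + 1

instance {n : ℕ} (T : Filling n) : Decidable (IsDualMarginallyLarge T) :=
  inferInstanceAs (Decidable (_ ∧ _))

/-- The set `SDT(-∞)` of dual marginally large semistandard decomposition tableaux. -/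
def SDTInf (n : ℕ) : Type := {T : Filling n // IsSDT T ∧ IsDualMarginallyLarge T}

/-- The weight on `SDT(-∞)`: the content of `T` minus the shape of `T`. This is the weight of `T`
tensored with the one-element crystal that shifts weights so that the tableau whose `j`-th row from
the bottom contains only `j`'s has weight `0`. -/
def weight {n : ℕ} (T : Filling n) : Fin n → ℤ :=
  fun a => (∑ j : Fin n, ((T j).count a : ℤ)) - ((T a).length : ℤ)

/-- A box of a filling: its row, its position within the row from the left, and its entry. -/
structure Box (n : ℕ) where
  row : Fin n
  col : ℕ
  entry : Fin n

/-- The reading word `rd(T)`, as a list of boxes: rows from the top to the bottom, each row from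
right to left. -/
def reading {n : ℕ} (T : Filling n) : List (Box n) :=
  (List.finRange n).reverse.flatMap fun j =>
    ((T j).zipIdx.map fun p => (⟨j, p.2, p.1⟩ : Box n)).reverse

/-- The subword of the reading word of those boxes whose entry is the letter `i` or its
successor. -/
def readingPair {n : ℕ} (i : ℕ) (T : Filling n) : List (Box n) :=
  (reading T).filter fun b => decide (b.entry.val = i ∨ b.entry.val = i + 1)

/-- Put a box in front of a reduced word, and cancel it if it holds `i + 1` and is followed by an
`i`. -/
def cancelCons {n : ℕ} (i : ℕ) (b : Box n) : List (Box n) → List (Box n)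
  | [] => [b]
  | c :: r => if b.entry.val = i + 1 ∧ c.entry.val = i then r else b :: c :: r

/-- The reduced word `red_i(T)`: successively remove all adjacent pairs of letters `(i + 1, i)`
(in that order) from the subword of letters `i` and `i + 1`. -/
def reduced {n : ℕ} (i : ℕ) (T : Filling n) : List (Box n) :=
  (readingPair i T).foldr (cancelCons i) []

/-- Change the entry of a box. -/
def setBox {n : ℕ} (T : Filling n) (b : Box n) (a : Fin n) : Filling n :=
  Function.update T b.row ((T b.row).set b.col a)

/-- Restore the dual marginally large condition, if necessary, after an `i` was changed to an
`i + 1`: remove the leftmost box (a `j`-box) from every row `j` with `j ≥ i + 1`, that is, push out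
a trivial column. -/
def restore {n : ℕ} (i : ℕ) (T : Filling n) : Filling n :=
  if IsDualMarginallyLarge T then T else fun j => if i < j.val then (T j).tail else T j

/-- The index set `I = {1, …, n - 1} ⊔ {1̄}` of the crystal operators, the even index `i` being
counted from `0`. The odd index `1̄` involves the two smallest letters, so it needs `n ≥ 2`. -/
inductive CrystalIndex (n : ℕ) : Type
  | even (i : ℕ) (h : i + 1 < n) : CrystalIndex n
  | odd (h : 1 < n) : CrystalIndex n

/-- The lowering operators of `SDT(-∞)`; `none` is the formal zero.

Even index `i`: if there is no `i` in `red_i(T)`, the value is zero; otherwise the box of the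
rightmost `i` in `red_i(T)` is changed to `i + 1`.

Odd index: look at the leftmost letter among all letters `1, 2` (here `0, 1`) of the reading word.
If it is `2`, the value is zero; if it is `1`, the box of that letter is changed to `2`. -/
def lower {n : ℕ} : CrystalIndex n → Filling n → Option (Filling n)
  | .even i h, T =>
    (((reduced i T).filter fun b => decide (b.entry.val = i)).getLast?).map
      fun b => restore i (setBox T b ⟨i + 1, h⟩)
  | .odd h, T =>
    match (readingPair 0 T).head? with
    | none => none
    | some b => if b.entry.val = 0 then some (restore 0 (setBox T b ⟨1, h⟩)) else none

/-- Lowest weight elements: all lowering operators, even and odd, vanish. -/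
def IsLowestWeight {n : ℕ} (T : Filling n) : Prop :=
  ∀ x : CrystalIndex n, lower x T = none

/-- The set `Φ⁺ = {ε_i - ε_j : i < j}` of positive roots in `ℤⁿ`. -/
def positiveRoots (n : ℕ) : Finset (Fin n → ℤ) :=
  ((Finset.univ : Finset (Fin n × Fin n)).filter fun p => p.1 < p.2).image
    fun p => Pi.single p.1 (1 : ℤ) - Pi.single p.2 (1 : ℤ)

end QueerCrystal

/-! The bijection is not constructed: the two sets are shown to have equally many elements of each
weight, by comparing generating functions.

Letters and rows are counted from `0`. In a dual marginally large tableau, row `j` is a run of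
`j`'s, whose length is forced by the row below, followed by a tail `v ++ u` of letters at most `j`:
`v` decreases weakly below `j`, and `u` increases strictly. The tails are arbitrary, they determine
the tableau, and they carry its weight. The even operators vanish exactly when every prefix of the
reading word contains at least as many letters `i + 1` as `i`, and then the odd operator vanishes
too. The long run of `k`'s in row `k` guarantees this condition for `k - 1` and `k` in all lower
rows, so after row `k` only the content of the letters below `k` matters.

Write `a_c = det (x_a ^ (c_i + i))`, so that `a_c / a_0` is a Schur polynomial. For families of `k`
tails that keep the ballot condition from a weakly increasing initial content `c`, the claim
(`alternant_mul_sum_families`) is `x^c * ∑ monomials = ∏_{i<j<k} (1 + x_i / x_j) * a_c / a_0`. For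
`c = 0` the right side is `∏ (1 + x_i / x_j)`, the generating function of the subsets of the
positive roots.

The claim follows by induction, removing the top row. The tails taking `c` to a monotone `μ` are as
numerous as the sets `S` for which `μ - 1_S` interlaces with `c` (`card_allowed`, `sum_rowData`).
The sum over tails thus becomes a sum of `a_{ν + 1_S}` over interlacing `ν` and all `S`; the Pieri
rule (`sum_alternant_add_indicator`) extracts the new factors `1 + x_i / x_k`, and the branching
rule (`alternant_succ`) assembles `a_c` in one more variable. -/

open Finset Matrix

namespace QueerCrystal

/-! ### Alternants: Pieri rule and branching rule -/

section Alternant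

variable {K : Type*} [Field K]

/-- The alternant `det (x_a ^ (c_i + i))`. -/
noncomputable def alternant (x : ℕ → K) (k : ℕ) (c : Fin k → ℕ) : K :=
  (Matrix.of fun i a : Fin k => x a ^ (c i + i.val)).det

theorem alternant_eq_zero (x : ℕ → K) {k : ℕ} {c : Fin k → ℕ} {i j : Fin k} (hij : i ≠ j)
    (h : c i + i.val = c j + j.val) : alternant x k c = 0 := by
  refine Matrix.det_zero_of_row_eq hij ?_
  ext a
  simp [h]

theorem alternant_zero_ne_zero {x : ℕ → K} {k : ℕ}
    (hx : ∀ i < k, ∀ j < k, x i = x j → i = j) : alternant x k 0 ≠ 0 := by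
  have h : alternant x k 0 = (Matrix.vandermonde fun a : Fin k => x a).det := by
    rw [alternant, ← Matrix.det_transpose]
    congr 1
    ext i j
    simp [Matrix.vandermonde]
  rw [h, Matrix.det_vandermonde_ne_zero_iff]
  intro i j hij
  exact Fin.ext (hx _ i.2 _ j.2 hij)

/-- Multiplication of an alternant by `∏ (1 + t x_a)`: the Pieri rule for vertical strips. -/
theorem sum_alternant_add_indicator (x : ℕ → K) (t : K) (k : ℕ) (c : Fin k → ℕ) :
    ∑ S : Finset (Fin k), t ^ #S * alternant x k (fun i => c i + if i ∈ S then 1 else 0) =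
      (∏ a : Fin k, (1 + t * x a)) * alternant x k c := by
  rw [alternant, ← Matrix.det_mul_row]
  -- Scaling column `a` by `1 + t * x a` splits each row into the old row plus `t` times the row
  -- with exponent raised by one; multilinearity expands over the set `S` of raised rows.
  have h := (Matrix.detRowAlternating (n := Fin k) (R := K)).toMultilinearMap.map_add_univ
    (fun i (a : Fin k) => t * x a ^ (c i + i.val + 1))
    (fun i (a : Fin k) => x a ^ (c i + i.val))
  have e : (Matrix.of fun i a : Fin k => (1 + t * x a) * (Matrix.of fun i a : Fin k =>
      x a ^ (c i + i.val)) i a) = ((fun i (a : Fin k) => t * x a ^ (c i + i.val + 1)) +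
        (fun i (a : Fin k) => x a ^ (c i + i.val)) : Fin k → Fin k → K) := by
    ext i a
    simp only [Matrix.of_apply, Pi.add_apply, pow_succ]
    ring
  rw [e]
  refine Eq.trans (Finset.sum_congr rfl fun S _ => ?_) h.symm
  have h2 := Matrix.det_mul_column (fun i : Fin k => if i ∈ S then t else 1)
    (Matrix.of fun i a : Fin k => x a ^ (c i + (if i ∈ S then 1 else 0) + i.val))
  rw [Finset.prod_ite_mem, Finset.univ_inter, Finset.prod_const] at h2
  rw [alternant, ← h2]
  change _ = Matrix.det _
  congr 1
  ext i a
  by_cases hi : i ∈ S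
  · simp [hi, Finset.piecewise]
    left; ring
  · simp [hi, Finset.piecewise]

/-- The tuples which interlace with `c`. -/
def interlacing {k : ℕ} (c : Fin (k + 1) → ℕ) : Finset (Fin k → ℕ) :=
  Fintype.piFinset fun i => Finset.Icc (c i.castSucc) (c i.succ)

/-- The branching rule for alternants. -/
theorem alternant_succ (x : ℕ → K) {k : ℕ} {c : Fin (k + 1) → ℕ} (hc : Monotone c) :
    alternant x (k + 1) c = (∏ a : Fin k, (x k - x a)) *
      ∑ ν ∈ interlacing c, x k ^ (c 0 + ∑ i, (c i.succ - ν i)) * alternant x k ν := by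
  have hgeom : ∀ (i : Fin k) (a : K), (a - x k) * ∑ b ∈ Finset.Icc (c i.castSucc) (c i.succ),
      x k ^ (c i.succ - b) * a ^ (b + i.val) =
      a ^ (c i.succ + (i.val + 1)) - x k ^ (c i.succ - c i.castSucc + 1) *
        a ^ (c i.castSucc + i.val) := by
    intro i a
    have hle : c i.castSucc ≤ c i.succ := hc (Fin.castSucc_lt_succ).le
    obtain ⟨d, hd⟩ := Nat.exists_eq_add_of_le hle
    have hI : Finset.Icc (c i.castSucc) (c i.succ) =
        (Finset.range (d + 1)).image (c i.castSucc + ·) := by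
      ext y
      simp only [Finset.mem_Icc, Finset.mem_image, Finset.mem_range]
      constructor
      · intro hy; exact ⟨y - c i.castSucc, by omega, by omega⟩
      · rintro ⟨z, hz, rfl⟩; omega
    rw [hI, Finset.sum_image (by intro p _ q _ h; simpa using h)]
    have hg := Commute.geom_sum₂_mul (Commute.all a (x k)) (d + 1)
    have : ∑ b ∈ Finset.range (d + 1), x k ^ (c i.succ - (c i.castSucc + b)) *
        a ^ (c i.castSucc + b + i.val) = a ^ (c i.castSucc + i.val) *
        ∑ b ∈ Finset.range (d + 1), a ^ b * x k ^ (d + 1 - 1 - b) := by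
      rw [Finset.mul_sum]
      refine Finset.sum_congr rfl fun b hb => ?_
      have : c i.succ - (c i.castSucc + b) = d + 1 - 1 - b := by omega
      rw [this]; ring
    rw [this, mul_left_comm, mul_comm (a - x k), hg, hd]
    have : c i.castSucc + d - c i.castSucc = d := by omega
    rw [this]; ring
  -- From each row of the alternant, subtract `x k ^ (gap + 1)` times the preceding row, so that the
  -- last column vanishes below its top entry. By `hgeom` the other entries become `x a - x k` times
  -- a geometric sum over the interlacing interval.
  let B : Matrix (Fin (k + 1)) (Fin (k + 1)) K := Matrix.of fun i a =>
    Fin.cases (x a ^ c 0) (fun j => (x a - x k) * ∑ b ∈ Finset.Icc (c j.castSucc) (c j.succ),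
      x k ^ (c j.succ - b) * x a ^ (b + j.val)) i
  have hB : alternant x (k + 1) c = B.det := by
    refine Matrix.det_eq_of_forall_row_eq_smul_add_pred
      (fun i => x k ^ (c i.succ - c i.castSucc + 1)) ?_ ?_
    · intro j; simp [B]
    · intro i j
      simp only [B, Matrix.of_apply, Fin.cases_succ, hgeom]
      simp
  rw [hB, Matrix.det_succ_column B (Fin.last k), Fin.sum_univ_succ]
  have h0 : ∀ i : Fin k, B i.succ (Fin.last k) = 0 := by
    intro i; simp [B]
  simp only [h0, mul_zero, zero_mul, Finset.sum_const_zero, add_zero]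
  have hsub : B.submatrix (Fin.succAbove 0) (Fin.succAbove (Fin.last k)) =
      Matrix.of fun i a : Fin k => (x a - x k) * (Matrix.of fun i a : Fin k =>
        ∑ b ∈ Finset.Icc (c i.castSucc) (c i.succ),
          x k ^ (c i.succ - b) * x a ^ (b + i.val)) i a := by
    ext i a
    simp [B]
  have hB0 : B 0 (Fin.last k) = x k ^ c 0 := by simp [B]
  rw [hsub, Matrix.det_mul_row, hB0]
  have hsum : (Matrix.of fun i a : Fin k => ∑ b ∈ Finset.Icc (c i.castSucc) (c i.succ),
          x k ^ (c i.succ - b) * x a ^ (b + i.val)).det =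
      ∑ ν ∈ interlacing c, x k ^ (∑ i, (c i.succ - ν i)) * alternant x k ν := by
    have h := (Matrix.detRowAlternating (n := Fin k) (R := K)).toMultilinearMap.map_sum_finset
      (fun i b (a : Fin k) => x k ^ (c i.succ - b) * x a ^ (b + i.val))
      (fun i => Finset.Icc (c i.castSucc) (c i.succ))
    have e : (Matrix.of fun i a : Fin k => ∑ b ∈ Finset.Icc (c i.castSucc) (c i.succ),
          x k ^ (c i.succ - b) * x a ^ (b + i.val)) = fun i =>
          ∑ b ∈ Finset.Icc (c i.castSucc) (c i.succ),
          fun a : Fin k => x k ^ (c i.succ - b) * x a ^ (b + i.val) := by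
      ext i a
      simp [Finset.sum_apply]
    rw [e]
    refine h.trans (Finset.sum_congr rfl fun ν _ => ?_)
    rw [alternant, ← Finset.prod_pow_eq_pow_sum, ← Matrix.det_mul_column]
    rfl
  rw [hsum]
  -- The sign from the reversed differences cancels the cofactor sign of the last column.
  have hsign : (∏ a : Fin k, (x a - x k)) = (-1) ^ k * ∏ a : Fin k, (x k - x a) := by
    rw [← Fin.prod_const k (-1 : K), ← Finset.prod_mul_distrib]
    exact Finset.prod_congr rfl fun a _ => by ring
  rw [hsign]
  have h1 : ((-1 : K) ^ k) * (-1) ^ k = 1 := by rw [← mul_pow]; simp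
  simp only [pow_add, mul_assoc, ← Finset.mul_sum]
  simp only [Fin.val_zero, Fin.val_last, pow_zero, one_mul]
  linear_combination (x k ^ c 0 * (∏ a : Fin k, (x k - x a)) *
    ∑ ν ∈ interlacing c, x k ^ (∑ i, (c i.succ - ν i)) * alternant x k ν) * h1

end Alternant

/-! ### Counting the changes of content caused by one row -/

section RowData

variable {k : ℕ}

theorem monotone_of_le_next {f : Fin k → ℕ} (h : ∀ i j : Fin k, i.val + 1 = j.val → f i ≤ f j) :
    Monotone f := by
  cases k with
  | zero => intro i; exact i.elim0
  | succ m => exact Fin.monotone_iff_le_succ.2 fun i => h _ _ (by simp)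

/-- The indices at which `μ` exceeds `c`. -/
def grown (c : Fin (k + 1) → ℕ) (μ : Fin k → ℕ) : Finset (Fin k) :=
  univ.filter fun i => c i.castSucc < μ i

/-- The indices at which `μ` exceeds the next entry of `c`. -/
def forced (c : Fin (k + 1) → ℕ) (μ : Fin k → ℕ) : Finset (Fin k) :=
  univ.filter fun i => c i.succ < μ i

open Classical in
/-- The letters which may occur in the strictly increasing part of a row word that changes the
content from `c` to `μ`. -/
noncomputable def allowed (c : Fin (k + 1) → ℕ) (μ : Fin k → ℕ) : Finset (Fin (k + 1)) :=
  univ.filter fun a =>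
    (∃ b ∈ grown c μ, b.castSucc < a) ∧ ∀ b : Fin k, b.castSucc = a → b ∈ grown c μ

theorem mem_allowed {c : Fin (k + 1) → ℕ} {μ : Fin k → ℕ} {a : Fin (k + 1)} :
    a ∈ allowed c μ ↔ (∃ b ∈ grown c μ, b.castSucc < a) ∧
      ∀ b : Fin k, b.castSucc = a → b ∈ grown c μ := by
  simp [allowed]

/-- The least grown letter cannot lie in the increasing part, since nothing smaller occurs. In
exchange the letter `k`, whose content is not tracked, becomes available as soon as some letter has
grown. -/
theorem card_allowed (c : Fin (k + 1) → ℕ) (μ : Fin k → ℕ) :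
    #(allowed c μ) = #(grown c μ) := by
  rcases (grown c μ).eq_empty_or_nonempty with h | h
  · have : allowed c μ = ∅ := by
      ext a; simp [mem_allowed, h]
    rw [h, this]; rfl
  · have hm := Finset.min'_mem _ h
    set m := (grown c μ).min' h
    have hle : ∀ b ∈ grown c μ, m ≤ b := fun b hb => Finset.min'_le _ b hb
    have : allowed c μ =
        insert (Fin.last k) (((grown c μ).erase m).map Fin.castSuccEmb) := by
      ext a
      simp only [mem_allowed, Finset.mem_insert, Finset.mem_map, Finset.mem_erase,
        Fin.coe_castSuccEmb]
      constructor
      · rintro ⟨⟨b, hb, hba⟩, h2⟩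
        rcases Fin.eq_castSucc_or_eq_last a with ⟨d, rfl⟩ | rfl
        · refine Or.inr ⟨d, ⟨?_, h2 d rfl⟩, rfl⟩
          rintro rfl
          exact absurd (hle b hb) (not_le.2 (by simpa using hba))
        · exact Or.inl rfl
      · rintro (rfl | ⟨d, ⟨hd, hd2⟩, rfl⟩)
        · exact ⟨⟨m, hm, Fin.castSucc_lt_last m⟩,
            fun b hb => absurd hb (Fin.castSucc_lt_last b).ne⟩
        · refine ⟨⟨m, hm, ?_⟩, fun b hb => ?_⟩
          · simpa using lt_of_le_of_ne (hle d hd2) (Ne.symm hd)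
          · rwa [Fin.castSucc_injective _ hb]
    rw [this, Finset.card_insert_of_notMem, Finset.card_map, Finset.card_erase_add_one hm]
    simp only [Finset.mem_map, Fin.coe_castSuccEmb, not_exists, not_and]
    intro b _ hb
    exact (Fin.castSucc_lt_last b).ne hb

theorem forced_subset_grown {c : Fin (k + 1) → ℕ} (hc : Monotone c) (μ : Fin k → ℕ) :
    forced c μ ⊆ grown c μ := by
  intro i hi
  simp only [forced, grown, Finset.mem_filter, Finset.mem_univ, true_and] at hi ⊢
  exact lt_of_le_of_lt (hc Fin.castSucc_lt_succ.le) hi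

theorem forced_map_subset_allowed {c : Fin (k + 1) → ℕ} (hc : Monotone c) {μ : Fin k → ℕ}
    (hμ : Monotone μ) : (forced c μ).map (Fin.succEmb k) ⊆ allowed c μ := by
  intro a ha
  obtain ⟨i, hi, rfl⟩ := Finset.mem_map.1 ha
  refine mem_allowed.2 ⟨⟨i, forced_subset_grown hc μ hi, Fin.castSucc_lt_succ⟩, fun b hb => ?_⟩
  simp only [forced, grown, Finset.mem_filter, Finset.mem_univ, true_and, Fin.coe_succEmb]
    at hi hb ⊢
  rw [hb]
  refine lt_of_lt_of_le hi (hμ ?_)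
  have := congrArg Fin.val hb
  simp at this
  exact Fin.le_def.2 (by omega)

open Classical in
/-- Parameters of the row words that keep the ballot condition for the content `c`: the new content
and the set of letters of the strictly increasing part. -/
noncomputable def rowData (c : Fin (k + 1) → ℕ) :
    Finset (Σ _ : Fin k → ℕ, Finset (Fin (k + 1))) :=
  ((Fintype.piFinset fun i : Fin k => Finset.Icc (c i.castSucc) (c i.succ + 1)).filter
    Monotone).sigma fun μ => Finset.Icc ((forced c μ).map (Fin.succEmb k)) (allowed c μ)

theorem mem_rowData {c : Fin (k + 1) → ℕ} {p : Σ _ : Fin k → ℕ, Finset (Fin (k + 1))} :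
    p ∈ rowData c ↔ ((∀ i, c i.castSucc ≤ p.1 i ∧ p.1 i ≤ c i.succ + 1) ∧ Monotone p.1) ∧
      (forced c p.1).map (Fin.succEmb k) ⊆ p.2 ∧ p.2 ⊆ allowed c p.1 := by
  simp [rowData]

/-- For fixed `μ` the increasing parts range over a Boolean interval from the shifted `forced` set
to `allowed`; it has the same size as the interval from `forced` to `grown`. The sets `S` of the
latter are exactly those for which `μ - 1_S` interlaces with `c`. Non-monotone `ν + 1_S` on the
right are harmless by `hf`. -/
theorem sum_rowData {K : Type*} [AddCommMonoid K] {c : Fin (k + 1) → ℕ} (hc : Monotone c)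
    (f : (Fin k → ℕ) → K)
    (hf : ∀ ν ∈ interlacing c, ∀ S : Finset (Fin k),
      ¬ Monotone (fun i => ν i + if i ∈ S then 1 else 0) →
        f (fun i => ν i + if i ∈ S then 1 else 0) = 0) :
    ∑ p ∈ rowData c, f p.1 =
      ∑ ν ∈ interlacing c, ∑ S : Finset (Fin k), f (fun i => ν i + if i ∈ S then 1 else 0) := by
  classical
  have h1 : ∑ p ∈ rowData c, f p.1 = ∑ p ∈ ((Fintype.piFinset fun i : Fin k =>
      Finset.Icc (c i.castSucc) (c i.succ + 1)).filter Monotone).sigma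
        fun μ => Finset.Icc (forced c μ) (grown c μ), f p.1 := by
    rw [rowData, Finset.sum_sigma, Finset.sum_sigma]
    refine Finset.sum_congr rfl fun μ hμ => ?_
    change ∑ _s ∈ _, f μ = ∑ _s ∈ _, f μ
    rw [Finset.sum_const, Finset.sum_const, Finset.card_Icc_finset, Finset.card_Icc_finset,
      card_allowed, Finset.card_map]
    · exact forced_subset_grown hc μ
    · exact forced_map_subset_allowed hc (Finset.mem_filter.1 hμ).2
  rw [h1, ← Finset.sum_product' (interlacing c) Finset.univ
    (fun ν S => f (fun i => ν i + if i ∈ S then 1 else 0))]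
  symm
  rw [← Finset.sum_filter_add_sum_filter_not _
    (fun p : (Fin k → ℕ) × Finset (Fin k) => Monotone fun i => p.1 i + if i ∈ p.2 then 1 else 0)]
  -- Once the non-monotone terms are dropped, `(ν, S) ↦ (ν + 1_S, S)` is a bijection onto the pairs
  -- `(μ, S)`.
  rw [Finset.sum_eq_zero (s := Finset.filter (fun x => ¬ _) _), add_zero]
  · refine Finset.sum_bij' (fun p _ => ⟨fun i => p.1 i + if i ∈ p.2 then 1 else 0, p.2⟩)
      (fun p _ => (fun i => p.1 i - if i ∈ p.2 then 1 else 0, p.2)) ?_ ?_ ?_ ?_ ?_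
    · rintro ⟨ν, S⟩ h
      simp only [interlacing, Finset.mem_filter, Finset.mem_product, Fintype.mem_piFinset,
        Finset.mem_Icc, Finset.mem_univ, and_true] at h
      simp only [Finset.mem_sigma, Finset.mem_filter, Fintype.mem_piFinset, Finset.mem_Icc]
      refine ⟨⟨fun i => ?_, h.2⟩, fun i hi => ?_, fun i hi => ?_⟩
      · have := h.1 i
        split_ifs <;> omega
      · have := h.1 i
        simp only [forced, Finset.mem_filter, Finset.mem_univ, true_and] at hi
        by_contra hS
        rw [if_neg hS] at hi
        omega
      · have := h.1 i
        simp only [grown, Finset.mem_filter, Finset.mem_univ, true_and]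
        rw [if_pos hi]
        omega
    · rintro ⟨μ, S⟩ h
      simp only [Finset.mem_sigma, Finset.mem_filter, Fintype.mem_piFinset, Finset.mem_Icc] at h
      have hb : ∀ i, i ∈ S → 1 ≤ μ i := fun i hi => by
        have := h.2.2 hi
        simp only [grown, Finset.mem_filter, Finset.mem_univ, true_and] at this
        omega
      have he : (fun i => (μ i - if i ∈ S then 1 else 0) + if i ∈ S then 1 else 0) = μ := by
        funext i
        split_ifs with hi
        · have := hb i hi; omega
        · rfl
      simp only [interlacing, Finset.mem_filter, Finset.mem_product, Fintype.mem_piFinset,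
        Finset.mem_Icc, Finset.mem_univ, and_true, he]
      refine ⟨fun i => ?_, h.1.2⟩
      have h1 := h.1.1 i
      split_ifs with hi
      · have := h.2.2 hi
        simp only [grown, Finset.mem_filter, Finset.mem_univ, true_and] at this
        omega
      · have : i ∉ forced c μ := fun h' => hi (h.2.1 h')
        simp only [forced, Finset.mem_filter, Finset.mem_univ, true_and] at this
        omega
    · rintro ⟨ν, S⟩ h
      simp
    · rintro ⟨μ, S⟩ h
      simp only [Finset.mem_sigma, Finset.mem_Icc] at h
      have he : (fun i => (μ i - if i ∈ S then 1 else 0) + if i ∈ S then 1 else 0) = μ := by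
        funext i
        split_ifs with hi
        · have := h.2.2 hi
          simp only [grown, Finset.mem_filter, Finset.mem_univ, true_and] at this
          omega
        · rfl
      simp [he]
    · rintro ⟨ν, S⟩ h
      rfl
  · rintro ⟨ν, S⟩ h
    simp only [Finset.mem_filter, Finset.mem_product] at h
    exact hf ν h.1.1 S h.2

end RowData

/-! ### Row words and their encoding by content and increasing part -/

section RowWords

theorem prefix_append_cases {α : Type*} {q l₁ l₂ : List α} (h : q <+: l₁ ++ l₂) :
    q <+: l₁ ∨ ∃ t, q = l₁ ++ t ∧ t <+: l₂ := by
  obtain ⟨r, hr⟩ := h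
  rcases List.append_eq_append_iff.1 hr with ⟨s, h1, h2⟩ | ⟨s, h1, h2⟩
  · exact Or.inl ⟨s, h1.symm⟩
  · exact Or.inr ⟨s, h1, ⟨r, h2.symm⟩⟩

/-- `v ++ u` is a hook word whose weakly decreasing part `v` has letters below `k` and whose
strictly increasing part `u` has letters at most `k`. -/
structure IsRowSplit (k : ℕ) (v u : List ℕ) : Prop where
  left : v.Pairwise (· ≥ ·)
  right : u.Pairwise (· < ·)
  left_lt : ∀ a ∈ v, a < k
  right_le : ∀ a ∈ u, a ≤ k
  exists_lt : ∀ a ∈ u, ∃ b ∈ v, b < a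

/-- Were `v'` longer, it would contain a letter of `u` after a smaller letter of `v`, contradicting
weak decrease. The condition `exists_lt` thus makes the splitting unique. -/
theorem IsRowSplit.length_le {k : ℕ} {v u v' u' : List ℕ} (h : IsRowSplit k v u)
    (h' : IsRowSplit k v' u') (e : v ++ u = v' ++ u') : v'.length ≤ v.length := by
  rcases List.append_eq_append_iff.1 e with ⟨t, h1, h2⟩ | ⟨t, h1, h2⟩
  · cases t with
    | nil => simp [h1]
    | cons a t =>
      exfalso
      obtain ⟨b, hb, hba⟩ := h.exists_lt a (by simp [h2])
      have := h'.left
      rw [h1, List.pairwise_append] at this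
      have := this.2.2 b hb a (by simp)
      omega
  · simp [h1]

theorem IsRowSplit.unique {k : ℕ} {v u v' u' : List ℕ} (h : IsRowSplit k v u)
    (h' : IsRowSplit k v' u') (e : v ++ u = v' ++ u') : v = v' ∧ u = u' :=
  List.append_inj e (le_antisymm (h'.length_le h e.symm) (h.length_le h' e))

/-- The word `v ++ u` is admissible for row `k` with respect to the content `c`. -/
def IsRowWord (k : ℕ) (c : Fin (k + 1) → ℕ) (w : List ℕ) : Prop :=
  ∃ v u, w = v ++ u ∧ IsRowSplit k v u ∧
    ∀ i : Fin k, c i.castSucc + w.count i.val ≤ c i.succ + u.count (i.val + 1)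

variable {k : ℕ}

/-- The weakly decreasing part of the row word with the given parameters. -/
def decPart (c : Fin (k + 1) → ℕ) (p : Σ _ : Fin k → ℕ, Finset (Fin (k + 1))) : List ℕ :=
  (List.finRange k).reverse.flatMap fun i =>
    List.replicate (p.1 i - c i.castSucc - if i.castSucc ∈ p.2 then 1 else 0) i.val

/-- The strictly increasing part of the row word with the given parameters. -/
def incPart (p : Σ _ : Fin k → ℕ, Finset (Fin (k + 1))) : List ℕ :=
  ((List.finRange (k + 1)).filter (· ∈ p.2)).map Fin.val

theorem pairwise_decPart (c : Fin (k + 1) → ℕ) (p : Σ _ : Fin k → ℕ, Finset (Fin (k + 1))) :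
    (decPart c p).Pairwise (· ≥ ·) := by
  rw [decPart, List.pairwise_flatMap]
  refine ⟨fun a _ => List.pairwise_replicate.2 (Or.inr le_rfl), ?_⟩
  rw [List.pairwise_reverse]
  refine (List.pairwise_lt_finRange k).imp fun {a b} hab x hx y hy => ?_
  rw [List.eq_of_mem_replicate hx, List.eq_of_mem_replicate hy]
  exact hab.le

theorem pairwise_incPart (p : Σ _ : Fin k → ℕ, Finset (Fin (k + 1))) :
    (incPart p).Pairwise (· < ·) := by
  rw [incPart, List.pairwise_map]
  exact ((List.pairwise_lt_finRange (k + 1)).filter _).imp fun h => h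

theorem mem_incPart {p : Σ _ : Fin k → ℕ, Finset (Fin (k + 1))} {a : ℕ} :
    a ∈ incPart p ↔ ∃ i ∈ p.2, i.val = a := by
  simp [incPart]

theorem mem_decPart {c : Fin (k + 1) → ℕ} {p : Σ _ : Fin k → ℕ, Finset (Fin (k + 1))} {a : ℕ} :
    a ∈ decPart c p ↔
      ∃ i : Fin k, p.1 i - c i.castSucc - (if i.castSucc ∈ p.2 then 1 else 0) ≠ 0 ∧ a = i.val := by
  simp only [decPart, List.mem_flatMap, List.mem_reverse, List.mem_finRange, true_and,
    List.mem_replicate]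

theorem count_decPart (c : Fin (k + 1) → ℕ) (p : Σ _ : Fin k → ℕ, Finset (Fin (k + 1)))
    (i : Fin k) : (decPart c p).count i.val =
      p.1 i - c i.castSucc - if i.castSucc ∈ p.2 then 1 else 0 := by
  rw [decPart, List.count_flatMap, List.map_reverse, List.sum_reverse, ← List.ofFn_eq_map,
    List.sum_ofFn, Finset.sum_eq_single i]
  · simp
  · intro b _ hb
    simp only [Function.comp, List.count_replicate]
    rw [if_neg]
    simpa [Fin.ext_iff] using hb
  · simp

theorem count_incPart (p : Σ _ : Fin k → ℕ, Finset (Fin (k + 1))) (i : Fin (k + 1)) :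
    (incPart p).count i.val = if i ∈ p.2 then 1 else 0 := by
  have hn : (incPart p).Nodup := (pairwise_incPart p).imp fun h => h.ne
  split_ifs with h
  · exact List.count_eq_one_of_mem hn (mem_incPart.2 ⟨i, h, rfl⟩)
  · refine List.count_eq_zero_of_not_mem fun h' => h ?_
    obtain ⟨j, hj, e⟩ := mem_incPart.1 h'
    rwa [← Fin.ext e]

theorem indicator_le_of_mem_rowData {c : Fin (k + 1) → ℕ}
    {p : Σ _ : Fin k → ℕ, Finset (Fin (k + 1))} (hp : p ∈ rowData c) (i : Fin k) :
    (if i.castSucc ∈ p.2 then 1 else 0) ≤ p.1 i - c i.castSucc := by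
  split_ifs with h
  · have := (mem_allowed.1 ((mem_rowData.1 hp).2.2 h)).2 i rfl
    simp only [grown, Finset.mem_filter, Finset.mem_univ, true_and] at this
    omega
  · omega

theorem add_count_rowData {c : Fin (k + 1) → ℕ}
    {p : Σ _ : Fin k → ℕ, Finset (Fin (k + 1))} (hp : p ∈ rowData c) (i : Fin k) :
    c i.castSucc + (decPart c p ++ incPart p).count i.val = p.1 i := by
  have h := indicator_le_of_mem_rowData hp i
  have h2 := ((mem_rowData.1 hp).1.1 i).1
  have h3 := count_incPart p i.castSucc
  rw [Fin.val_castSucc] at h3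
  rw [List.count_append, count_decPart, h3]
  omega

theorem isRowSplit_of_mem_rowData {c : Fin (k + 1) → ℕ}
    {p : Σ _ : Fin k → ℕ, Finset (Fin (k + 1))} (hp : p ∈ rowData c) :
    IsRowSplit k (decPart c p) (incPart p) := by
  refine ⟨pairwise_decPart c p, pairwise_incPart p, fun a ha => ?_, fun a ha => ?_, fun a ha => ?_⟩
  · obtain ⟨i, _, rfl⟩ := mem_decPart.1 ha
    exact i.2
  · obtain ⟨i, _, rfl⟩ := mem_incPart.1 ha
    omega
  · obtain ⟨i, hi, rfl⟩ := mem_incPart.1 ha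
    obtain ⟨b, hb, hbi⟩ := (mem_allowed.1 ((mem_rowData.1 hp).2.2 hi)).1
    have hne : (grown c p.1).Nonempty := ⟨b, hb⟩
    have hm := Finset.min'_mem _ hne
    have hle : ∀ b ∈ grown c p.1, (grown c p.1).min' hne ≤ b :=
      fun b hb => Finset.min'_le _ b hb
    set m := (grown c p.1).min' hne
    refine ⟨m.val, mem_decPart.2 ⟨m, ?_, rfl⟩, ?_⟩
    -- The least grown letter lies outside the increasing part, so its growth must come from the
    -- decreasing part: it is the smaller letter required by `exists_lt`.
    · have hm' : m.castSucc ∉ p.2 := fun h => by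
        obtain ⟨d, hd, hdm⟩ := (mem_allowed.1 ((mem_rowData.1 hp).2.2 h)).1
        exact absurd (hle d hd) (not_le.2 (by simpa using hdm))
      simp only [grown, Finset.mem_filter, Finset.mem_univ, true_and] at hm
      rw [if_neg hm']
      omega
    · have h1 : m.val ≤ b.val := hle b hb
      have h2 : b.val < i.val := hbi
      omega

theorem injOn_rowData (c : Fin (k + 1) → ℕ) :
    Set.InjOn (fun p => decPart c p ++ incPart p) (rowData c : Set _) := by
  intro p hp q hq h
  obtain ⟨-, hu⟩ := (isRowSplit_of_mem_rowData hp).unique (isRowSplit_of_mem_rowData hq) h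
  have h1 : p.1 = q.1 := by
    funext i
    rw [← add_count_rowData hp i, ← add_count_rowData hq i]
    exact congrArg (fun l : List ℕ => c i.castSucc + l.count i.val) h
  have h2 : p.2 = q.2 := by
    ext i
    have := @mem_incPart k p i.val
    have h3 := @mem_incPart k q i.val
    rw [hu] at this
    simp only [Fin.val_inj, exists_eq_right] at this h3
    exact this.symm.trans h3
  cases p; cases q
  simp only at h1 h2
  subst h1 h2
  rfl

/-- The finite set of admissible row words. -/
noncomputable def rowWords (k : ℕ) (c : Fin (k + 1) → ℕ) : Finset (List ℕ) :=
  (rowData c).image fun p => decPart c p ++ incPart p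

/-- A word is recovered from its new content and the letter set of `u`: the latter gives `u`, and
subtracting it from the growth gives the multiplicities in `v`. The ballot inequality forces the
letter `i + 1` into `u` when the content of `i` exceeds the old content of `i + 1`. -/
theorem mem_rowWords {c : Fin (k + 1) → ℕ} {w : List ℕ} :
    w ∈ rowWords k c ↔ IsRowWord k c w := by
  rw [rowWords, Finset.mem_image]
  constructor
  · rintro ⟨p, hp, rfl⟩
    refine ⟨_, _, rfl, isRowSplit_of_mem_rowData hp, fun i => ?_⟩
    have h3 := count_incPart p i.succ
    rw [Fin.val_succ] at h3
    rw [add_count_rowData hp, h3]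
    have hp' := mem_rowData.1 hp
    split_ifs with h
    · exact (hp'.1.1 i).2
    · have : i ∉ forced c p.1 := fun hi => h (hp'.2.1 (Finset.mem_map.2 ⟨i, hi, rfl⟩))
      simpa [forced] using this
  · rintro ⟨v, u, rfl, hs, hb⟩
    have hn : u.Nodup := hs.right.imp fun h => h.ne
    have hcu : ∀ a, u.count a = if a ∈ u then 1 else 0 := fun a => by
      split_ifs with h
      · exact List.count_eq_one_of_mem hn h
      · exact List.count_eq_zero_of_not_mem h
    let p : Σ _ : Fin k → ℕ, Finset (Fin (k + 1)) :=
      ⟨fun i => c i.castSucc + (v ++ u).count i.val, univ.filter fun a => a.val ∈ u⟩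
    have hgrown : ∀ i : Fin k, i ∈ grown c p.1 ↔ i.val ∈ v ++ u := fun i => by
      simp only [grown, p, Finset.mem_filter, Finset.mem_univ, true_and]
      rw [← List.count_pos_iff (l := v ++ u)]
      omega
    have hp : p ∈ rowData c := by
      refine mem_rowData.2 ⟨⟨fun i => ⟨Nat.le_add_right _ _, ?_⟩, ?_⟩, ?_, ?_⟩
      · refine (hb i).trans ?_
        rw [hcu]
        split_ifs <;> omega
      · refine monotone_of_le_next fun i j hij => (hb i).trans ?_
        have : i.succ = j.castSucc := Fin.ext (by simp [hij])
        change _ ≤ c j.castSucc + (v ++ u).count j.val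
        rw [this, hij, List.count_append]
        omega
      · intro a ha
        obtain ⟨i, hi, rfl⟩ := Finset.mem_map.1 ha
        simp only [forced, p, Finset.mem_filter, Finset.mem_univ, true_and] at hi ⊢
        have := hb i
        rw [hcu] at this
        by_contra h
        simp only [Fin.coe_succEmb, Fin.val_succ] at h
        rw [if_neg h] at this
        omega
      · intro a ha
        simp only [p, Finset.mem_filter, Finset.mem_univ, true_and] at ha
        obtain ⟨b, hbv, hba⟩ := hs.exists_lt _ ha
        refine mem_allowed.2 ⟨⟨⟨b, hs.left_lt b hbv⟩, (hgrown _).2 (by simp [hbv]), hba⟩,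
          fun d hd => (hgrown d).2 ?_⟩
        rw [← hd] at ha
        simpa using Or.inr ha
    refine ⟨p, hp, ?_⟩
    have hu : incPart p = u := by
      refine List.Perm.eq_of_pairwise (le := (· < ·)) (fun a b _ _ h h' => by omega)
        (pairwise_incPart p) hs.right ?_
      refine (List.perm_ext_iff_of_nodup ((pairwise_incPart p).imp fun h => h.ne) hn).2 fun a => ?_
      rw [mem_incPart]
      constructor
      · rintro ⟨i, hi, rfl⟩
        simpa [p] using hi
      · intro ha
        exact ⟨⟨a, Nat.lt_succ_of_le (hs.right_le a ha)⟩, by simpa [p] using ha, rfl⟩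
    have hv : decPart c p = v := by
      refine List.Perm.eq_of_pairwise (le := (· ≥ ·)) (fun a b _ _ h h' => by omega)
        (pairwise_decPart c p) hs.left ?_
      refine List.perm_iff_count.2 fun a => ?_
      by_cases ha : a < k
      · rw [count_decPart c p ⟨a, ha⟩]
        simp only [p, Finset.mem_filter, Finset.mem_univ, true_and, List.count_append, hcu,
          Fin.castSucc_mk]
        split_ifs <;> omega
      · rw [List.count_eq_zero_of_not_mem, List.count_eq_zero_of_not_mem]
        · exact fun h => ha (hs.left_lt a h)
        · intro h
          obtain ⟨i, _, rfl⟩ := mem_decPart.1 h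
          exact ha i.2
    change decPart c p ++ incPart p = v ++ u
    rw [hu, hv]

theorem sum_rowWords {K : Type*} [AddCommMonoid K] {c : Fin (k + 1) → ℕ} (hc : Monotone c)
    (f : (Fin k → ℕ) → K)
    (hf : ∀ ν ∈ interlacing c, ∀ S : Finset (Fin k),
      ¬ Monotone (fun i => ν i + if i ∈ S then 1 else 0) →
        f (fun i => ν i + if i ∈ S then 1 else 0) = 0) :
    ∑ w ∈ rowWords k c, f (fun i => c i.castSucc + w.count i.val) =
      ∑ ν ∈ interlacing c, ∑ S : Finset (Fin k), f (fun i => ν i + if i ∈ S then 1 else 0) := by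
  rw [rowWords, Finset.sum_image (injOn_rowData c), ← sum_rowData hc f hf]
  refine Finset.sum_congr rfl fun p hp => congrArg f (funext fun i => ?_)
  exact add_count_rowData hp i

theorem IsRowWord.monotone {c : Fin (k + 1) → ℕ} {w : List ℕ} (h : IsRowWord k c w) :
    Monotone fun i : Fin k => c i.castSucc + w.count i.val := by
  obtain ⟨v, u, rfl, hs, hb⟩ := h
  refine monotone_of_le_next fun i j hij => (hb i).trans ?_
  have : i.succ = j.castSucc := Fin.ext (by simp [hij])
  rw [this, hij]
  simp only [List.count_append]
  omega

/-- The ballot condition on prefixes of a row word, read from right to left, in terms of the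
contents only. -/
theorem ballot_iff {c : Fin (k + 1) → ℕ} (hc : Monotone c) {v u : List ℕ}
    (hs : IsRowSplit k v u) :
    (∀ i : Fin k, ∀ q, q <+: (v ++ u).reverse →
      c i.castSucc + q.count i.val ≤ c i.succ + q.count (i.val + 1)) ↔
    ∀ i : Fin k, c i.castSucc + (v ++ u).count i.val ≤ c i.succ + u.count (i.val + 1) := by
  rw [List.reverse_append]
  have hvr : v.reverse.Pairwise (· ≤ ·) := List.pairwise_reverse.2 hs.left
  constructor
  -- The critical prefix consists of all of `u` and the letters of `v` up to `i`: every `i` has been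
  -- read, but no `i + 1` from `v`.
  · intro h i
    have h1 := h i (u.reverse ++ v.reverse.takeWhile (· ≤ i.val))
      ((List.prefix_append_right_inj _).2 (List.takeWhile_prefix _))
    have h2 : (v.reverse.takeWhile (· ≤ i.val)).count (i.val + 1) = 0 := by
      refine List.count_eq_zero_of_not_mem fun hm => ?_
      have := List.mem_takeWhile_imp hm
      simp at this
    have h3 : (v.reverse.takeWhile (· ≤ i.val)).count i.val = v.count i.val := by
      have e := List.takeWhile_append_dropWhile (p := (decide <| · ≤ i.val)) (l := v.reverse)
      have e2 := congrArg (List.count i.val) e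
      rw [List.count_append, List.count_reverse] at e2
      suffices (v.reverse.dropWhile (· ≤ i.val)).count i.val = 0 by omega
      refine List.count_eq_zero_of_not_mem fun hm => ?_
      obtain ⟨a, t, hat⟩ := List.exists_cons_of_ne_nil (List.ne_nil_of_mem hm)
      have ha := List.head_dropWhile_not (decide <| · ≤ i.val) (List.ne_nil_of_mem hm)
      have hp : (v.reverse.dropWhile (· ≤ i.val)).Pairwise (· ≤ ·) :=
        hvr.sublist (List.dropWhile_sublist _)
      have ha' : ¬ a ≤ i.val := by simpa [hat] using ha
      rw [hat] at hm hp
      rcases List.mem_cons.1 hm with hm | hm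
      · omega
      · have := List.rel_of_pairwise_cons hp hm
        omega
    rw [List.count_append, List.count_append, h2, h3, List.count_reverse, List.count_reverse] at h1
    rw [List.count_append]
    omega
  -- Within `u`, read in decreasing order, an `i + 1` precedes `i`. If `i` occurs in `u` without `i
  -- + 1`, the inequality for the whole word already leaves room for it.
  · intro h i q hq
    have hi := h i
    have hci := hc (Fin.castSucc_lt_succ (i := i)).le
    have hn : u.Nodup := hs.right.imp fun h => h.ne
    rcases prefix_append_cases hq with hq | ⟨t, rfl, ht⟩
    · by_cases hiq : i.val ∈ q
      · have hq1 : q.count i.val ≤ 1 :=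
          (hq.sublist.count_le _).trans
            (by rw [List.count_reverse]; exact List.nodup_iff_count_le_one.1 hn _)
        have hiu : i.val ∈ u := List.mem_reverse.1 (hq.subset hiq)
        by_cases hsu : i.val + 1 ∈ u
        · have : i.val + 1 ∈ q := by
            obtain ⟨t, ht⟩ := hq
            have hp : u.reverse.Pairwise (· > ·) := List.pairwise_reverse.2 hs.right
            have hm : i.val + 1 ∈ q ++ t := by rw [ht]; simpa using hsu
            rw [← ht, List.pairwise_append] at hp
            rcases List.mem_append.1 hm with hm | hm
            · exact hm
            · have := hp.2.2 _ hiq _ hm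
              omega
          have := List.count_pos_iff.2 this
          omega
        · rw [List.count_eq_zero_of_not_mem hsu] at hi
          have : 1 ≤ (v ++ u).count i.val := List.count_pos_iff.2 (by simp [hiu])
          omega
      · rw [List.count_eq_zero_of_not_mem hiq]
        omega
    · have h1 := ht.sublist.count_le i.val
      rw [List.count_reverse] at h1
      rw [List.count_append] at hi ⊢
      rw [List.count_append, List.count_reverse, List.count_reverse]
      omega

end RowWords

/-! ### The generating function of ballot families -/

section Families

/-- The content of the letters below `k` after a row word `w` has been read. -/
def nextContent {k : ℕ} (c : Fin (k + 1) → ℕ) (w : List ℕ) : Fin k → ℕ :=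
  fun i => c i.castSucc + w.count i.val

/-- Families of row words, from row `k - 1` down to row `0`, which keep the ballot condition when
started with the content `c`. -/
def IsFamily : (k : ℕ) → (Fin k → ℕ) → List (List ℕ) → Prop
  | 0, _, l => l = []
  | k + 1, c, l => ∃ w l', l = w :: l' ∧ IsRowWord k c w ∧ IsFamily k (nextContent c w) l'

/-- The finite set of all families with `IsFamily k c`. -/
noncomputable def families : (k : ℕ) → (Fin k → ℕ) → Finset (List (List ℕ))
  | 0, _ => {[]}
  | k + 1, c => (rowWords k c).biUnion fun w => (families k (nextContent c w)).image (w :: ·)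

theorem mem_families {k : ℕ} {c : Fin k → ℕ} {l : List (List ℕ)} :
    l ∈ families k c ↔ IsFamily k c l := by
  induction k generalizing l with
  | zero => simp [families, IsFamily]
  | succ k ih =>
    simp only [families, IsFamily, Finset.mem_biUnion, Finset.mem_image, mem_rowWords, ih]
    constructor
    · rintro ⟨w, hw, l', hl', rfl⟩
      exact ⟨w, l', rfl, hw, hl'⟩
    · rintro ⟨w, l', rfl, hw, hl'⟩
      exact ⟨w, hw, l', hl', rfl⟩

theorem IsFamily.length_eq {k : ℕ} {c : Fin k → ℕ} {l : List (List ℕ)} (h : IsFamily k c l) :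
    l.length = k := by
  induction k generalizing l with
  | zero => simp [show l = [] from h]
  | succ k ih =>
    obtain ⟨w, l', rfl, -, hl'⟩ := h
    simp [ih hl']

variable {K : Type*} [Field K]

/-- The monomial of the weight of a family. -/
noncomputable def familyMonomial (x : ℕ → K) : List (List ℕ) → K
  | [] => 1
  | w :: l => (∏ i : Fin l.length, (x i / x l.length) ^ w.count i.val) * familyMonomial x l

theorem sum_families_succ (x : ℕ → K) {k : ℕ} (c : Fin (k + 1) → ℕ) :
    ∑ l ∈ families (k + 1) c, familyMonomial x l =
      ∑ w ∈ rowWords k c, (∏ i : Fin k, (x i / x k) ^ w.count i.val) *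
        ∑ l ∈ families k (nextContent c w), familyMonomial x l := by
  rw [families, Finset.sum_biUnion]
  · refine Finset.sum_congr rfl fun w _ => ?_
    rw [Finset.sum_image (by intro a _ b _ h; simpa using h), Finset.mul_sum]
    refine Finset.sum_congr rfl fun l hl => ?_
    have hk := (mem_families.1 hl).length_eq
    subst hk
    rfl
  · intro w _ w' _ hne
    simp only [Function.onFun, Finset.disjoint_left, Finset.mem_image, not_exists, not_and]
    rintro _ ⟨l, _, rfl⟩ l' _ h
    exact hne (List.cons.inj h).1.symm

theorem alternant_succ_zero (x : ℕ → K) (k : ℕ) :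
    alternant x (k + 1) 0 = (∏ a : Fin k, (x k - x a)) * alternant x k 0 := by
  rw [alternant_succ x (c := 0) (fun _ _ _ => le_rfl)]
  have : interlacing (0 : Fin (k + 1) → ℕ) = {0} := by
    ext ν
    simp only [interlacing, Fintype.mem_piFinset, Finset.mem_Icc, Pi.zero_apply,
      Finset.mem_singleton]
    exact ⟨fun h => funext fun i => le_antisymm (h i).2 (h i).1, fun h i => by simp [h]⟩
  rw [this]
  simp

theorem le_of_mem_interlacing {k : ℕ} {c : Fin (k + 1) → ℕ} {ν : Fin k → ℕ}
    (h : ν ∈ interlacing c) (i : Fin k) : c i.castSucc ≤ ν i ∧ ν i ≤ c i.succ := by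
  simpa using Fintype.mem_piFinset.1 h i

theorem monotone_of_mem_interlacing {k : ℕ} {c : Fin (k + 1) → ℕ} {ν : Fin k → ℕ}
    (h : ν ∈ interlacing c) : Monotone ν :=
  monotone_of_le_next fun i j hij => by
    have : i.succ = j.castSucc := Fin.ext (by simp [hij])
    exact (le_of_mem_interlacing h i).2.trans (this ▸ (le_of_mem_interlacing h j).1)

/-- Monotonicity can fail only where two neighbouring entries of `ν` agree and just the first is
raised; the shift by the index then makes two rows equal. -/
theorem alternant_eq_zero_of_not_monotone (x : ℕ → K) {k : ℕ} {ν : Fin k → ℕ} (hν : Monotone ν)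
    {S : Finset (Fin k)} (h : ¬ Monotone fun i => ν i + if i ∈ S then 1 else 0) :
    alternant x k (fun i => ν i + if i ∈ S then 1 else 0) = 0 := by
  have : ∃ i j : Fin k, i.val + 1 = j.val ∧
      ¬ ((ν i + if i ∈ S then 1 else 0) ≤ ν j + if j ∈ S then 1 else 0) := by
    by_contra hcon
    push Not at hcon
    exact h (monotone_of_le_next hcon)
  obtain ⟨i, j, hij, hlt⟩ := this
  have hle : ν i ≤ ν j := hν (Fin.le_def.2 (by omega))
  refine alternant_eq_zero x (i := i) (j := j) (fun e => by simp [e] at hij) ?_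
  split_ifs at hlt ⊢ <;> omega

/-- The weight of the boxes of the last letter in the interlacing sum. -/
theorem sum_castSucc_add {k : ℕ} {c : Fin (k + 1) → ℕ} {ν : Fin k → ℕ}
    (h : ν ∈ interlacing c) :
    c 0 + ∑ i, (c i.succ - ν i) + ∑ i, (ν i - c i.castSucc) = c (Fin.last k) := by
  have h1 : ∑ i, (c i.succ - ν i) + ∑ i, (ν i - c i.castSucc) + ∑ i : Fin k, c i.castSucc =
      ∑ i : Fin k, c i.succ := by
    rw [← Finset.sum_add_distrib, ← Finset.sum_add_distrib]
    refine Finset.sum_congr rfl fun i _ => ?_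
    have := le_of_mem_interlacing h i
    omega
  have h2 := Fin.sum_univ_succ c
  have h3 := Fin.sum_univ_castSucc c
  omega

/-- The generating function of the families, as a product. -/
theorem alternant_mul_sum_families (x : ℕ → K) (hx : ∀ i, x i ≠ 0) (k : ℕ) (c : Fin k → ℕ)
    (hc : Monotone c) :
    alternant x k 0 * ((∏ i : Fin k, x i ^ c i) * ∑ l ∈ families k c, familyMonomial x l) =
      (∏ j ∈ Finset.range k, ∏ i : Fin j, (1 + x i / x j)) * alternant x k c := by
  induction k with
  | zero =>
    simp [families, familyMonomial, alternant]
  | succ k ih =>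
    -- The contribution of the top row depends only on the new content `μ`: each added letter `i <
    -- k` costs a factor `x k` in the denominator, while an added letter `k` has weight zero.
    let f : (Fin k → ℕ) → K := fun μ =>
      x k ^ c (Fin.last k) * (∏ i : Fin k, x k ^ (μ i - c i.castSucc))⁻¹ * alternant x k μ
    have hword : ∀ w ∈ rowWords k c,
        alternant x k 0 * ((∏ i : Fin (k + 1), x i ^ c i) *
          ((∏ i : Fin k, (x i / x k) ^ w.count i.val) *
            ∑ l ∈ families k (nextContent c w), familyMonomial x l)) =
        (∏ j ∈ Finset.range k, ∏ i : Fin j, (1 + x i / x j)) * f (nextContent c w) := by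
      intro w hw
      have h := ih (nextContent c w) (mem_rowWords.1 hw).monotone
      have hp : ∏ i : Fin k, x i ^ nextContent c w i =
          (∏ i : Fin k, x i ^ c i.castSucc) * ∏ i : Fin k, x i ^ w.count i.val := by
        rw [← Finset.prod_mul_distrib]
        exact Finset.prod_congr rfl fun i _ => pow_add _ _ _
      have hq : ∏ i : Fin k, (x i / x k) ^ w.count i.val =
          (∏ i : Fin k, x i ^ w.count i.val) * (∏ i : Fin k, x k ^ w.count i.val)⁻¹ := by
        rw [← Finset.prod_inv_distrib, ← Finset.prod_mul_distrib]
        exact Finset.prod_congr rfl fun i _ => by rw [div_pow, div_eq_mul_inv]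
      have hf : f (nextContent c w) = x k ^ c (Fin.last k) *
          (∏ i : Fin k, x k ^ w.count i.val)⁻¹ * alternant x k (nextContent c w) := by
        simp [f, nextContent]
      rw [hf, hq, Fin.prod_univ_castSucc]
      rw [hp] at h
      simp only [Fin.val_castSucc, Fin.val_last]
      linear_combination (x k ^ c (Fin.last k) * (∏ i : Fin k, x k ^ w.count i.val)⁻¹) * h
    have hsum : ∑ w ∈ rowWords k c, f (nextContent c w) =
        (∏ i : Fin k, (1 + x i / x k)) *
          ∑ ν ∈ interlacing c, x k ^ (c 0 + ∑ i, (c i.succ - ν i)) * alternant x k ν := by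
      have h := sum_rowWords hc f fun ν hν S hS => by
        simp [f, alternant_eq_zero_of_not_monotone x (monotone_of_mem_interlacing hν) hS]
      refine h.trans ?_
      rw [Finset.mul_sum]
      refine Finset.sum_congr rfl fun ν hν => ?_
      have hS := sum_alternant_add_indicator x (x k)⁻¹ k ν
      have hprod : ∏ i : Fin k, (1 + x i / x k) = ∏ a : Fin k, (1 + (x k)⁻¹ * x a) :=
        Finset.prod_congr rfl fun i _ => by rw [div_eq_inv_mul]
      rw [hprod, mul_left_comm, ← hS, Finset.mul_sum]
      refine Finset.sum_congr rfl fun S _ => ?_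
      have he : ∑ i, (ν i + (if i ∈ S then 1 else 0) - c i.castSucc) =
          ∑ i, (ν i - c i.castSucc) + #S := by
        have : #S = ∑ i : Fin k, if i ∈ S then 1 else 0 := by simp
        rw [this, ← Finset.sum_add_distrib]
        refine Finset.sum_congr rfl fun i _ => ?_
        have := le_of_mem_interlacing hν i
        omega
      simp only [f]
      -- The power of `x k` left after removing the factor `(x k)⁻¹ ^ #S` is exactly the one in the
      -- branching rule.
      rw [Finset.prod_pow_eq_pow_sum, he, ← sum_castSucc_add hν]
      have hxk := hx k
      rw [pow_add _ _ (#S), pow_add _ _ (∑ i, (ν i - c i.castSucc)), inv_pow]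
      field_simp
    rw [sum_families_succ, Finset.mul_sum, Finset.mul_sum, alternant_succ_zero,
      Finset.prod_range_succ, alternant_succ x hc]
    have : ∀ w ∈ rowWords k c, (∏ a : Fin k, (x k - x a)) * alternant x k 0 *
        ((∏ i : Fin (k + 1), x i ^ c i) * ((∏ i : Fin k, (x i / x k) ^ w.count i.val) *
            ∑ l ∈ families k (nextContent c w), familyMonomial x l)) =
        (∏ a : Fin k, (x k - x a)) * (∏ j ∈ Finset.range k, ∏ i : Fin j, (1 + x i / x j)) *
          f (nextContent c w) := fun w hw => by
      rw [mul_assoc, hword w hw, mul_assoc]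
    rw [Finset.sum_congr rfl this, ← Finset.mul_sum, hsum]
    ring

/-- The generating function of the families with zero initial content. -/
theorem sum_families_zero (x : ℕ → K) (hx : ∀ i, x i ≠ 0) {n : ℕ}
    (hinj : ∀ i < n, ∀ j < n, x i = x j → i = j) :
    ∑ l ∈ families n 0, familyMonomial x l =
      ∏ j ∈ Finset.range n, ∏ i : Fin j, (1 + x i / x j) := by
  have h := alternant_mul_sum_families x hx n 0 (fun _ _ _ => le_rfl)
  rw [mul_comm (∏ j ∈ Finset.range n, _)] at h
  simpa using mul_left_cancel₀ (alternant_zero_ne_zero hinj) h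

end Families

/-! ### From whole rows to row tails -/

section Rows

/-- The number of boxes of the row below row `j`. -/
def boxesBelow (R : ℕ → List ℕ) (j : ℕ) : ℕ :=
  if 0 < j then (R (j - 1)).length else 0

/-- Row `j` consists of the prescribed number of leading `j`-boxes and a word `v ++ u` as in
`IsRowSplit`. -/
def IsStandardRow (R : ℕ → List ℕ) (j : ℕ) : Prop :=
  ∃ v u, R j = List.replicate (boxesBelow R j + 1) j ++ (v ++ u) ∧ IsRowSplit j v u

/-- The part of row `j` after the leading `j`-boxes. -/
def rowTail (R : ℕ → List ℕ) (j : ℕ) : List ℕ :=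
  (R j).drop (boxesBelow R j + 1)

/-- The row tails of the rows `k - 1, …, 0`. -/
def rowTails (R : ℕ → List ℕ) : ℕ → List (List ℕ)
  | 0 => []
  | k + 1 => rowTail R k :: rowTails R k

/-- The reading word of the rows `k - 1, …, 0`. -/
def readRows (R : ℕ → List ℕ) : ℕ → List ℕ
  | 0 => []
  | k + 1 => (R k).reverse ++ readRows R k

theorem rowTail_of_eq {R : ℕ → List ℕ} {j : ℕ} {w : List ℕ}
    (h : R j = List.replicate (boxesBelow R j + 1) j ++ w) : rowTail R j = w := by
  rw [rowTail, h]
  exact List.drop_left' (by simp)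

theorem IsStandardRow.eq_append {R : ℕ → List ℕ} {j : ℕ} (h : IsStandardRow R j) :
    R j = List.replicate (boxesBelow R j + 1) j ++ rowTail R j := by
  obtain ⟨v, u, h1, -⟩ := h
  rw [rowTail_of_eq h1]
  exact h1

theorem IsStandardRow.le_of_mem {R : ℕ → List ℕ} {j : ℕ} (h : IsStandardRow R j) {a : ℕ}
    (ha : a ∈ R j) : a ≤ j := by
  obtain ⟨v, u, h1, hs⟩ := h
  rw [h1] at ha
  simp only [List.mem_append] at ha
  rcases ha with ha | ha | ha
  · exact (List.eq_of_mem_replicate ha).le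
  · exact (hs.left_lt a ha).le
  · exact hs.right_le a ha

theorem lt_of_mem_readRows {R : ℕ → List ℕ} {k : ℕ} (h : ∀ j < k, IsStandardRow R j) {a : ℕ}
    (ha : a ∈ readRows R k) : a < k := by
  induction k with
  | zero => simp [readRows] at ha
  | succ k ih =>
    rcases List.mem_append.1 ha with ha | ha
    · exact Nat.lt_succ_of_le ((h k (by omega)).le_of_mem (List.mem_reverse.1 ha))
    · exact (ih (fun j hj => h j (by omega)) ha).trans (by omega)

/-- Among the rows below `k`, the letter `k - 1` fits only into row `k - 1`, so the length of that
row bounds its occurrences. -/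
theorem count_readRows_le {R : ℕ → List ℕ} {k i : ℕ} (h : ∀ j < k, IsStandardRow R j)
    (hi : i + 1 = k) : (readRows R k).count i ≤ boxesBelow R k := by
  subst hi
  have h0 : (readRows R i).count i = 0 :=
    List.count_eq_zero_of_not_mem fun hm =>
      absurd (lt_of_mem_readRows (fun j hj => h j (by omega)) hm) (lt_irrefl _)
  rw [readRows, List.count_append, h0, List.count_reverse, boxesBelow, if_pos (by omega)]
  simpa using List.count_le_length

/-- The ballot condition on the prefixes of the reading word, row by row. -/
theorem ballot_readRows_iff {R : ℕ → List ℕ} {k : ℕ} (h : ∀ j < k, IsStandardRow R j)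
    {c : Fin k → ℕ} (hc : Monotone c) :
    (∀ i j : Fin k, i.val + 1 = j.val → ∀ q, q <+: readRows R k →
      c i + q.count i.val ≤ c j + q.count j.val) ↔ IsFamily k c (rowTails R k) := by
  induction k with
  | zero => simp [IsFamily, rowTails]
  | succ k ih =>
    obtain ⟨v, u, hR, hs⟩ := h k (by omega)
    have ht := rowTail_of_eq hR
    have hlow : ∀ j < k, IsStandardRow R j := fun j hj => h j (by omega)
    have hfam : IsFamily (k + 1) c (rowTails R (k + 1)) ↔
        IsRowWord k c (v ++ u) ∧ IsFamily k (nextContent c (v ++ u)) (rowTails R k) := by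
      simp only [IsFamily, rowTails, ht]
      constructor
      · rintro ⟨w, l, e, hw, hl⟩
        obtain ⟨rfl, rfl⟩ := List.cons.inj e
        exact ⟨hw, hl⟩
      · rintro ⟨hw, hl⟩
        exact ⟨_, _, rfl, hw, hl⟩
    have hword : IsRowWord k c (v ++ u) ↔ ∀ i : Fin k, ∀ q, q <+: (v ++ u).reverse →
        c i.castSucc + q.count i.val ≤ c i.succ + q.count (i.val + 1) := by
      rw [ballot_iff hc hs]
      constructor
      · rintro ⟨v', u', e, hs', hb⟩
        obtain ⟨rfl, rfl⟩ := hs.unique hs' e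
        exact hb
      · intro hb
        exact ⟨v, u, rfl, hs, hb⟩
    have hread : readRows R (k + 1) = (v ++ u).reverse ++
        (List.replicate (boxesBelow R k + 1) k ++ readRows R k) := by
      rw [readRows, hR, List.reverse_append (as := List.replicate _ _), List.append_assoc,
        List.reverse_replicate]
    have hcount : ∀ i : Fin k, ∀ m : ℕ, (List.replicate m k).count i.val = 0 := fun i m =>
      List.count_eq_zero_of_not_mem fun hm =>
        absurd (List.eq_of_mem_replicate hm) i.2.ne
    rw [hfam, hread]
    constructor
    · intro hb
      have hw : IsRowWord k c (v ++ u) := hword.2 fun i q hq =>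
        hb i.castSucc i.succ (by simp) q (hq.trans (List.prefix_append _ _))
      refine ⟨hw, (ih hlow hw.monotone).1 fun i j hij q hq => ?_⟩
      have := hb i.castSucc j.castSucc (by simpa using hij)
        ((v ++ u).reverse ++ (List.replicate (boxesBelow R k + 1) k ++ q))
        ((List.prefix_append_right_inj _).2 ((List.prefix_append_right_inj _).2 hq))
      rw [List.count_append, List.count_append, List.count_append, List.count_append] at this
      simp only [List.count_reverse, Fin.val_castSucc, hcount] at this
      omega
    · rintro ⟨hw, hf⟩ i j hij q hq
      have hwb := hword.1 hw
      have hfb := (ih hlow hw.monotone).2 hf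
      have hik : i.val < k := by omega
      obtain ⟨i, rfl⟩ : ∃ i' : Fin k, i = i'.castSucc := ⟨⟨i.val, hik⟩, rfl⟩
      obtain rfl : j = i.succ := Fin.ext (by simpa using hij.symm)
      simp only [Fin.val_castSucc, Fin.val_succ]
      have hall := hwb i (v ++ u).reverse List.prefix_rfl
      rcases prefix_append_cases hq with hq | ⟨t, rfl, hqt⟩
      · exact hwb i q hq
      rcases prefix_append_cases hqt with hqs | ⟨s, rfl, hqs⟩
      · have : t.count i.val = 0 := by
          have := hqs.sublist.count_le i.val
          rw [hcount] at this
          omega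
        rw [List.count_append, List.count_append]
        omega
      · rw [List.count_append, List.count_append, List.count_append, List.count_append, hcount]
        by_cases hi : i.val + 1 < k
        · have := hfb i ⟨i.val + 1, hi⟩ rfl s hqs
          simp only at this
          rw [List.count_reverse, List.count_reverse]
          have e : (⟨i.val + 1, hi⟩ : Fin k).castSucc = i.succ := rfl
          rw [e] at this
          omega
        -- The leading run of row `k` supplies more `k`'s than there are letters `k - 1` in all
        -- lower rows, so this inequality is automatic.
        · have hik : i.val + 1 = k := by omega
          have h1 := hqs.sublist.count_le i.val
          have h2 := count_readRows_le hlow hik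
          have h3 : (List.replicate (boxesBelow R k + 1) k).count (i.val + 1) =
              boxesBelow R k + 1 := by
            rw [hik, List.count_replicate_self]
          omega

theorem rowTail_congr {R R' : ℕ → List ℕ} {j : ℕ} (h : ∀ i ≤ j, R i = R' i) :
    boxesBelow R j = boxesBelow R' j ∧ rowTail R j = rowTail R' j := by
  have : boxesBelow R j = boxesBelow R' j := by
    simp only [boxesBelow]
    rw [h (j - 1) (by omega)]
  exact ⟨this, by rw [rowTail, rowTail, this, h j le_rfl]⟩

theorem rowTails_congr {R R' : ℕ → List ℕ} {k : ℕ} (h : ∀ i < k, R i = R' i) :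
    rowTails R k = rowTails R' k := by
  induction k with
  | zero => rfl
  | succ k ih =>
    rw [rowTails, rowTails, ih fun i hi => h i (by omega),
      (rowTail_congr fun i hi => h i (by omega)).2]

theorem isStandardRow_congr {R R' : ℕ → List ℕ} {j : ℕ} (h : ∀ i ≤ j, R i = R' i)
    (hR : IsStandardRow R j) : IsStandardRow R' j := by
  rw [IsStandardRow, h j le_rfl, (rowTail_congr h).1] at hR
  exact hR

/-- Rows are rebuilt from the bottom: the row below fixes the length of the leading run, and the
tail supplies the rest. -/
theorem eq_of_rowTails_eq {R R' : ℕ → List ℕ} {k : ℕ} (h : ∀ j < k, IsStandardRow R j)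
    (h' : ∀ j < k, IsStandardRow R' j) (e : rowTails R k = rowTails R' k) :
    ∀ j < k, R j = R' j := by
  induction k with
  | zero => intro j hj; omega
  | succ k ih =>
    obtain ⟨e1, e2⟩ := List.cons.inj e
    have hlow := ih (fun j hj => h j (by omega)) (fun j hj => h' j (by omega)) e2
    intro j hj
    rcases Nat.lt_succ_iff_lt_or_eq.1 hj with hj | rfl
    · exact hlow j hj
    · have hb : boxesBelow R j = boxesBelow R' j := by
        simp only [boxesBelow]
        split_ifs with h0
        · rw [hlow (j - 1) (by omega)]
        · rfl
      rw [(h j (by omega)).eq_append, (h' j (by omega)).eq_append, hb, e1]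

theorem exists_rows_of_isFamily {k : ℕ} {c : Fin k → ℕ} {l : List (List ℕ)}
    (h : IsFamily k c l) :
    ∃ R : ℕ → List ℕ, (∀ j < k, IsStandardRow R j) ∧ rowTails R k = l := by
  induction k generalizing l with
  | zero => exact ⟨fun _ => [], by simp, by simp [rowTails, show l = [] from h]⟩
  | succ k ih =>
    obtain ⟨w, l', rfl, ⟨v, u, rfl, hs, -⟩, hl⟩ := h
    obtain ⟨R, hR, rfl⟩ := ih hl
    let R' := Function.update R k (List.replicate (boxesBelow R k + 1) k ++ (v ++ u))
    have hlow : ∀ i < k, R i = R' i := fun i hi => by simp [R', hi.ne]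
    have hb : boxesBelow R' k = boxesBelow R k := by
      simp only [boxesBelow]
      split_ifs with h0
      · rw [hlow (k - 1) (by omega)]
      · rfl
    have hk : R' k = List.replicate (boxesBelow R' k + 1) k ++ (v ++ u) := by
      rw [hb]; simp [R']
    refine ⟨R', fun j hj => ?_, ?_⟩
    · rcases Nat.lt_succ_iff_lt_or_eq.1 hj with hj | rfl
      · exact isStandardRow_congr (fun i hi => hlow i (by omega)) (hR j hj)
      · exact ⟨v, u, hk, hs⟩
    · rw [rowTails, rowTail_of_eq hk, ← rowTails_congr hlow]

end Rows

/-! ### Hook words -/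

section HookWords

theorem IsHookWord.map_val {n : ℕ} {w : List (Fin n)} (h : IsHookWord w) :
    IsHookWord (w.map Fin.val) := by
  obtain ⟨v, x, u, rfl, h1, h2⟩ := h
  refine ⟨v.map Fin.val, x.val, u.map Fin.val, by simp, ?_, ?_⟩
  · have := (List.pairwise_map (f := Fin.val) (R := (· ≥ ·)) (l := v ++ [x])).2
      (h1.imp fun h => h)
    simpa using this
  · have := (List.pairwise_map (f := Fin.val) (R := (· < ·)) (l := x :: u)).2
      (h2.imp fun h => h)
    simpa using this

theorem IsHookWord.of_map_val {n : ℕ} {w : List (Fin n)} (h : IsHookWord (w.map Fin.val)) :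
    IsHookWord w := by
  obtain ⟨v, x, u, e, h1, h2⟩ := h
  obtain ⟨v', w', rfl, rfl, e'⟩ := List.map_eq_append_iff.1 e
  obtain ⟨x', u', rfl, rfl, rfl⟩ := List.map_eq_cons_iff.1 e'
  refine ⟨v', x', u', rfl, ?_, ?_⟩
  · have : (List.map Fin.val (v' ++ [x'])).Pairwise (· ≥ ·) := by simpa using h1
    exact (List.pairwise_map.1 this).imp fun h => h
  · have : (List.map Fin.val (x' :: u')).Pairwise (· < ·) := by simpa using h2
    exact (List.pairwise_map.1 this).imp fun h => h

/-- After its first ascent, a hook word is strictly increasing. -/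
theorem IsHookWord.lt_of_sublist {α : Type*} [LinearOrder α] {w : List α} (h : IsHookWord w)
    {a b d : α} (hs : [a, b, d].Sublist w) (hab : a < b) : b < d := by
  obtain ⟨v, x, u, rfl, h1, h2⟩ := h
  rw [show v ++ x :: u = (v ++ [x]) ++ u by simp] at hs
  obtain ⟨s, t, e, hs1, hs2⟩ := List.sublist_append_iff.1 hs
  have hp := h1.sublist hs1
  have hq := (List.pairwise_cons.1 h2).2.sublist hs2
  match s, e with
  | [], e =>
    simp only [List.nil_append] at e
    subst e
    simp only [List.pairwise_cons, List.mem_cons] at hq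
    exact hq.2.1 d (by simp)
  | [s], e =>
    simp only [List.cons_append, List.nil_append, List.cons.injEq] at e
    obtain ⟨-, rfl⟩ := e
    exact List.rel_of_pairwise_cons hq (by simp)
  | s :: s' :: r, e =>
    simp only [List.cons_append, List.cons.injEq] at e
    obtain ⟨rfl, rfl, -⟩ := e
    exact absurd hab (not_lt.2 (List.rel_of_pairwise_cons hp (by simp)))

theorem IsHookWord.cons {α : Type*} [LinearOrder α] {a b : α} {w : List α}
    (h : IsHookWord (b :: w)) (hab : b ≤ a) : IsHookWord (a :: b :: w) := by
  obtain ⟨v, x, u, e, h1, h2⟩ := h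
  refine ⟨a :: v, x, u, by simp [e], ?_, h2⟩
  rw [List.cons_append, List.pairwise_cons]
  refine ⟨fun d hd => ?_, h1⟩
  have hle : d ≤ b := by
    cases v with
    | nil =>
      simp only [List.nil_append, List.cons.injEq, List.mem_singleton] at e hd
      exact (hd.trans e.1.symm).le
    | cons y v =>
      simp only [List.cons_append, List.cons.injEq, List.mem_cons] at e hd
      rcases hd with rfl | hd
      · exact e.1.symm.le
      · rw [e.1]
        exact List.rel_of_pairwise_cons h1 hd
  exact hle.trans hab

/-- The turning point is the last, hence least, letter of the decreasing block; `exists_lt` puts all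
of `u` above it. -/
theorem IsRowSplit.isHookWord {j m : ℕ} {v u : List ℕ} (h : IsRowSplit j v u) :
    IsHookWord (List.replicate (m + 1) j ++ (v ++ u)) := by
  have hp : (List.replicate (m + 1) j ++ v).Pairwise (· ≥ ·) := by
    rw [List.pairwise_append]
    refine ⟨List.pairwise_replicate.2 (Or.inr le_rfl), h.left, fun a ha b hb => ?_⟩
    rw [List.eq_of_mem_replicate ha]
    exact (h.left_lt b hb).le
  rcases List.eq_nil_or_concat (List.replicate (m + 1) j ++ v) with e | ⟨v', x, e⟩
  · simp [List.replicate_succ] at e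
  · rw [List.concat_eq_append] at e
    refine ⟨v', x, u, ?_, e ▸ hp, ?_⟩
    · rw [← List.append_assoc, e, List.append_assoc]; rfl
    · refine List.pairwise_cons.2 ⟨fun a ha => ?_, h.right⟩
      obtain ⟨b, hb, hba⟩ := h.exists_lt a ha
      have hb' : b ∈ v' ++ [x] := by rw [← e]; simp [hb]
      rw [e, List.pairwise_append] at hp
      rcases List.mem_append.1 hb' with hb' | hb'
      · exact lt_of_le_of_lt (hp.2.2 b hb' x (by simp)) hba
      · rwa [← List.mem_singleton.1 hb']

/-- A hook word which starts with exactly `m + 1` letters `j` and has no letter above `j`. -/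
theorem IsHookWord.exists_isRowSplit {j m : ℕ} {t : List ℕ}
    (h : IsHookWord (List.replicate (m + 1) j ++ t)) (ht : t.head? ≠ some j)
    (hle : ∀ a ∈ t, a ≤ j) : ∃ v u, t = v ++ u ∧ IsRowSplit j v u := by
  obtain ⟨v, x, u, e, h1, h2⟩ := h
  rw [show v ++ x :: u = (v ++ [x]) ++ u by simp] at e
  have h3 := List.pairwise_cons.1 h2
  rcases List.append_eq_append_iff.1 e with ⟨s, e1, e2⟩ | ⟨s, e1, e2⟩
  · rw [e1, List.pairwise_append] at h1
    have hlt : ∀ a ∈ s, a < j := by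
      cases s with
      | nil => simp
      | cons y s =>
        have hy : y ≤ j := h1.2.2 j (by simp) y (by simp)
        have hne : y ≠ j := by
          rintro rfl
          exact ht (by simp [e2])
        intro a ha
        rcases List.mem_cons.1 ha with rfl | ha
        · omega
        · have : y ≥ a := List.rel_of_pairwise_cons h1.2.1 ha
          omega
    refine ⟨s, u, e2, h1.2.1, h3.2, hlt, fun a ha => hle a (by simp [e2, ha]), fun a ha => ?_⟩
    refine ⟨x, ?_, h3.1 a ha⟩
    have hx : x ∈ List.replicate (m + 1) j ++ s := by rw [← e1]; simp
    rcases List.mem_append.1 hx with hx | hx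
    · have h4 := h3.1 a ha
      rw [List.eq_of_mem_replicate hx] at h4
      have := hle a (by simp [e2, ha])
      omega
    · exact hx
  -- Here the hook turns inside the leading run. Any continuation would have to rise above `j`, so
  -- `t` is empty.
  · cases s with
    | nil =>
      have hx : x = j := by
        refine List.eq_of_mem_replicate (n := m + 1) ?_
        rw [e1]; simp
      simp only [List.nil_append] at e2
      cases u with
      | nil => exact ⟨[], [], by simp [← e2], by constructor <;> simp⟩
      | cons a u =>
        have h4 := h3.1 a (by simp)
        have := hle a (by simp [← e2])
        omega
    | cons y s =>
      have hx : x = j := List.eq_of_mem_replicate (n := m + 1) (by rw [e1]; simp)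
      have hy : y = j := List.eq_of_mem_replicate (n := m + 1) (by rw [e1]; simp)
      have := h3.1 y (by simp [e2])
      omega

end HookWords

/-! ### Dual marginally large tableaux as sequences of standard rows -/

section Tableaux

variable {n : ℕ}

/-- The rows of a filling, with letters in `ℕ`. -/
def valRows (T : Filling n) (j : ℕ) : List ℕ :=
  if h : j < n then (T ⟨j, h⟩).map Fin.val else []

theorem valRows_val (T : Filling n) (j : Fin n) : valRows T j.val = (T j).map Fin.val := by
  rw [valRows, dif_pos j.2]

theorem valRows_injective {T T' : Filling n} (h : ∀ j < n, valRows T j = valRows T' j) :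
    T = T' := by
  funext j
  have := h j.val j.2
  rw [valRows_val, valRows_val] at this
  exact List.map_injective_iff.2 Fin.val_injective this

theorem exists_filling {R : ℕ → List ℕ} (h : ∀ j < n, IsStandardRow R j) :
    ∃ T : Filling n, ∀ j < n, valRows T j = R j := by
  refine ⟨fun j => (R j.val).map fun a => if ha : a < n then ⟨a, ha⟩ else j, fun j hj => ?_⟩
  rw [valRows, dif_pos hj, List.map_map]
  conv_rhs => rw [← List.map_id (R j)]
  refine List.map_congr_left fun a ha => ?_
  have : a < n := lt_of_le_of_lt ((h j hj).le_of_mem ha) hj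
  simp [this]

theorem lengthBelow_eq (T : Filling n) (j : Fin n) :
    lengthBelow T j = boxesBelow (valRows T) j.val := by
  rw [lengthBelow, boxesBelow]
  split_ifs with h
  · rw [valRows, dif_pos (lt_of_le_of_lt (Nat.sub_le _ _) j.isLt), List.length_map]
  · rfl

theorem leadingCount_eq (T : Filling n) (j : Fin n) :
    leadingCount T j = ((valRows T j.val).takeWhile (fun a => decide (a = j.val))).length := by
  rw [leadingCount, valRows_val, List.takeWhile_map, List.length_map]
  congr 2
  funext a
  simp [Fin.ext_iff]

theorem boxesBelow_succ (T : Filling n) {i j : Fin n} (hij : i.val + 1 = j.val) :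
    boxesBelow (valRows T) j.val = (T i).length := by
  rw [boxesBelow, if_pos (by omega), ← hij, Nat.add_sub_cancel, valRows_val, List.length_map]

theorem takeWhile_eq_replicate (j : ℕ) (l : List ℕ) :
    l.takeWhile (fun a => decide (a = j)) =
      List.replicate (l.takeWhile (fun a => decide (a = j))).length j :=
  List.eq_replicate_of_mem fun a ha => by simpa using List.mem_takeWhile_imp ha

/-- A letter of row `j` above `j` could be put in front of row `j + 1`, which starts with `j + 1`,
giving a hook subword that is too long. -/
theorem le_of_isSDT {T : Filling n} (hT : IsSDT T) (hD : IsDualMarginallyLarge T) (j : Fin n)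
    {a : Fin n} (ha : a ∈ T j) : a ≤ j := by
  by_contra hlt
  have hj : j.val + 1 < n := by have := a.2; have : j.val < a.val := not_le.1 hlt; omega
  let j' : Fin n := ⟨j.val + 1, hj⟩
  have hlead := hD.2 j'
  have hne := hD.1 j'
  obtain ⟨b, t, hbt⟩ := List.exists_cons_of_ne_nil hne
  have hb : b = j' := by
    by_contra hb
    rw [leadingCount, hbt] at hlead
    simp [hb] at hlead
  have hw : IsHookWord (a :: T j') := by
    have := hT.hook j' hne
    rw [hbt] at this ⊢
    refine this.cons ?_
    rw [hb]
    exact Fin.le_def.2 (not_le.1 hlt)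
  have := hT.maximal j j' rfl (hD.1 j) (a :: T j')
    (((List.singleton_sublist).2 ha).append (List.Sublist.refl (T j'))) hw
  simp at this

theorem isStandardRow_of_isSDT {T : Filling n} (hT : IsSDT T) (hD : IsDualMarginallyLarge T) :
    ∀ j < n, IsStandardRow (valRows T) j := by
  intro j hj
  have hlead := hD.2 ⟨j, hj⟩
  rw [leadingCount_eq, lengthBelow_eq] at hlead
  have hrow := List.takeWhile_append_dropWhile (p := fun a => decide (a = j)) (l := valRows T j)
  rw [takeWhile_eq_replicate, hlead] at hrow
  have hhook : IsHookWord (valRows T j) := by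
    have := (hT.hook ⟨j, hj⟩ (hD.1 _)).map_val
    rwa [← valRows_val] at this
  rw [← hrow] at hhook
  obtain ⟨v, u, hvu, hs⟩ := hhook.exists_isRowSplit
    (fun h => by
      have := List.head?_dropWhile_not (fun a => decide (a = j)) (valRows T j)
      rw [h] at this
      simp at this)
    (fun a ha => by
      have ha' : a ∈ valRows T j := (List.dropWhile_sublist _).subset ha
      rw [valRows, dif_pos hj] at ha'
      obtain ⟨b, hb, rfl⟩ := List.mem_map.1 ha'
      exact le_of_isSDT hT hD ⟨j, hj⟩ hb)
  exact ⟨v, u, by rw [← hvu]; exact hrow.symm, hs⟩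

theorem isDualMarginallyLarge_of_isStandardRow {T : Filling n}
    (h : ∀ j < n, IsStandardRow (valRows T) j) : IsDualMarginallyLarge T := by
  refine ⟨fun j hj => ?_, fun j => ?_⟩
  · obtain ⟨v, u, e, -⟩ := h j.val j.2
    rw [valRows_val, hj] at e
    simp [List.replicate_succ] at e
  · obtain ⟨v, u, e, hs⟩ := h j.val j.2
    rw [leadingCount_eq, lengthBelow_eq, e, List.takeWhile_append_of_pos]
    · have : (v ++ u).takeWhile (fun a => decide (a = j.val)) = [] := by
        cases v with
        | nil =>
          cases u with
          | nil => rfl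
          | cons a u => simpa using hs.exists_lt a (by simp)
        | cons a v =>
          have := hs.left_lt a (by simp)
          simp [this.ne]
      rw [this]
      simp
    · intro a ha
      simpa using List.eq_of_mem_replicate ha

/-- For maximality: a hook subword using a letter of the lower row, necessarily below `j`, ascends
at the first `j` of the run and so uses at most one of them. The run exceeds the lower row by one
box, so what the lower row can contribute never outweighs this loss. -/
theorem isSDT_of_isStandardRow {T : Filling n}
    (h : ∀ j < n, IsStandardRow (valRows T) j) : IsSDT T := by
  have hlen : ∀ j : Fin n, (T j).length = (valRows T j.val).length := fun j => by
    rw [valRows_val, List.length_map]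
  refine ⟨fun i j hij => Or.inl ?_, fun j _ => ?_, fun i j hij _ w hw hh => ?_⟩
  · obtain ⟨v, u, e, -⟩ := h j.val j.2
    rw [hlen j, e, boxesBelow_succ T hij, List.length_append, List.length_replicate]
    omega
  · obtain ⟨v, u, e, hs⟩ := h j.val j.2
    refine IsHookWord.of_map_val ?_
    rw [← valRows_val, e]
    exact hs.isHookWord
  · obtain ⟨v, u, e, -⟩ := h j.val j.2
    have hw' := hw.map Fin.val
    rw [List.map_append, ← valRows_val T j, e, boxesBelow_succ T hij] at hw'
    obtain ⟨w₁, w₂, e₁, h₁, h₂⟩ := List.sublist_append_iff.1 hw'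
    have hlw : w.length = w₁.length + w₂.length := by
      rw [← List.length_append, ← e₁, List.length_map]
    rw [hlen j, e, boxesBelow_succ T hij, hlw]
    cases w₁ with
    | nil => simpa using h₂.length_le
    | cons a w₁ =>
      obtain ⟨w₃, w₄, rfl, h₃, h₄⟩ := List.sublist_append_iff.1 h₂
      obtain ⟨m, -, rfl⟩ := List.sublist_replicate_iff.1 h₃
      have ha : a < j.val := by
        have ha := h₁.subset (List.mem_cons_self)
        rw [← valRows_val] at ha
        have := (h i.val i.2).le_of_mem ha
        omega
      have hm : m ≤ 1 := by
        by_contra hm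
        obtain ⟨m, rfl⟩ : ∃ m', m = m' + 2 := ⟨m - 2, by omega⟩
        have hh' := hh.map_val
        rw [e₁] at hh'
        have hsub : [a, j.val, j.val].Sublist
            (a :: w₁ ++ (List.replicate (m + 2) j.val ++ w₄)) := by
          rw [List.cons_append]
          refine List.Sublist.cons_cons a ?_
          refine List.Sublist.trans ?_ (List.sublist_append_right _ _)
          simp [List.replicate_succ]
        exact absurd (hh'.lt_of_sublist hsub ha) (lt_irrefl _)
      have l₁ := h₁.length_le
      have l₄ := h₄.length_le
      simp only [List.length_append, List.length_replicate, List.length_map] at l₁ l₄ ⊢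
      omega

end Tableaux

/-! ### Lowest weight as a ballot condition -/

section LowestWeight

variable {n : ℕ}

theorem readRows_eq_flatMap (R : ℕ → List ℕ) (k : ℕ) :
    readRows R k = (List.range k).reverse.flatMap fun j => (R j).reverse := by
  induction k with
  | zero => rfl
  | succ k ih => rw [readRows, ih, List.range_succ]; simp

theorem map_entry_reading (T : Filling n) :
    (reading T).map (fun b => b.entry.val) = readRows (valRows T) n := by
  rw [readRows_eq_flatMap, reading, List.map_flatMap, ← List.map_coe_finRange_eq_range,
    ← List.map_reverse, List.flatMap_map]
  congr 1
  funext j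
  rw [List.map_reverse, valRows_val, List.map_map]
  congr 1
  have : ((fun b : Box n => b.entry.val) ∘ fun p : Fin n × ℕ => (⟨j, p.2, p.1⟩ : Box n)) =
      Fin.val ∘ Prod.fst := rfl
  rw [this, ← List.map_map, List.zipIdx_map_fst]

theorem forall_prefix_cons {α : Type*} {P : List α → Prop} (a : α) (l : List α) :
    (∀ q, q <+: a :: l → P q) ↔ P [] ∧ ∀ q, q <+: l → P (a :: q) := by
  constructor
  · intro h
    exact ⟨h [] List.nil_prefix, fun q hq => h _ ((List.prefix_cons_inj a).2 hq)⟩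
  · rintro ⟨h0, h1⟩ q hq
    rcases List.prefix_cons_iff.1 hq with rfl | ⟨t, rfl, ht⟩
    · exact h0
    · exact h1 t ht

/-- The number of unmatched `i`'s measures the failure of the ballot condition. -/
theorem reduced_spec (i : ℕ) (L : List (Box n)) :
    let r := (L.filter fun b => decide (b.entry.val = i ∨ b.entry.val = i + 1)).foldr
      (cancelCons i) []
    (∀ b ∈ r, b.entry.val = i ∨ b.entry.val = i + 1) ∧
    r.Pairwise (fun a b => a.entry.val ≤ b.entry.val) ∧
    ∀ e : ℕ, (r.filter fun b => decide (b.entry.val = i)).length ≤ e ↔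
      ∀ q, q <+: L.map (fun b => b.entry.val) → q.count i ≤ q.count (i + 1) + e := by
  -- The slack `e` makes the induction work: prepending `i` lowers it by one, prepending `i + 1`
  -- raises it by one. Sortedness of the reduced word ensures that an `i + 1` which does not cancel
  -- has no `i` behind it.
  induction L with
  | nil => simp
  | cons b L ih =>
    simp only at ih ⊢
    obtain ⟨h1, h2, h3⟩ := ih
    by_cases hi : b.entry.val = i
    · rw [List.filter_cons_of_pos (by simp [hi]), List.foldr_cons]
      set r := (L.filter fun b => decide (b.entry.val = i ∨ b.entry.val = i + 1)).foldr
        (cancelCons i) [] with hr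
      have hc : cancelCons i b r = b :: r := by
        cases hr' : r with
        | nil => rfl
        | cons c s => simp [cancelCons, hi]
      rw [hc]
      refine ⟨?_, ?_, fun e => ?_⟩
      · intro d hd
        rcases List.mem_cons.1 hd with rfl | hd
        · exact Or.inl hi
        · exact h1 d hd
      · refine List.pairwise_cons.2 ⟨fun d hd => ?_, h2⟩
        have := h1 d hd
        omega
      · rw [List.filter_cons_of_pos (by simp [hi]), List.map_cons, forall_prefix_cons, hi,
          List.length_cons]
        simp only [List.count_cons_self, List.count_cons_of_ne (show i ≠ i + 1 by omega)]
        cases e with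
        | zero =>
          refine ⟨fun h => by omega, fun h => ?_⟩
          have := h.2 [] List.nil_prefix
          simp at this
        | succ e =>
          rw [Nat.add_le_add_iff_right, h3 e]
          constructor
          · intro h
            exact ⟨by simp, fun q hq => by have := h q hq; omega⟩
          · intro h q hq
            have := h.2 q hq
            omega
    · by_cases hi' : b.entry.val = i + 1
      · rw [List.filter_cons_of_pos (by simp [hi']), List.foldr_cons]
        set r := (L.filter fun b => decide (b.entry.val = i ∨ b.entry.val = i + 1)).foldr
          (cancelCons i) [] with hr
        have hprefix : ∀ e : ℕ, (∀ q, q <+: (b :: L).map (fun b => b.entry.val) →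
            q.count i ≤ q.count (i + 1) + e) ↔
            (r.filter fun b => decide (b.entry.val = i)).length ≤ e + 1 := by
          intro e
          rw [h3 (e + 1), List.map_cons, forall_prefix_cons, hi']
          simp only [List.count_cons_self, List.count_cons_of_ne (show i + 1 ≠ i by omega)]
          constructor
          · intro h q hq
            have := h.2 q hq
            omega
          · intro h
            exact ⟨by simp, fun q hq => by have := h q hq; omega⟩
        cases hr' : r with
        | nil =>
          rw [hr'] at hprefix
          refine ⟨?_, ?_, fun e => ?_⟩
          · simp [cancelCons, hi']
          · simp [cancelCons]
          · rw [hprefix]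
            simp [cancelCons, hi']
        | cons c s =>
          rw [hr'] at h1 h2 hprefix
          have h4 := List.pairwise_cons.1 h2
          by_cases hc : c.entry.val = i
          · have e1 : cancelCons i b (c :: s) = s := by simp [cancelCons, hi', hc]
            rw [e1]
            refine ⟨fun d hd => h1 d (by simp [hd]), h4.2, fun e => ?_⟩
            rw [hprefix, List.filter_cons_of_pos (by simp [hc]), List.length_cons]
            omega
          · have e1 : cancelCons i b (c :: s) = b :: c :: s := by simp [cancelCons, hc]
            have hci : c.entry.val = i + 1 := (h1 c (by simp)).resolve_left hc
            have hall : ∀ d ∈ c :: s, i + 1 ≤ d.entry.val := by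
              intro d hd
              rcases List.mem_cons.1 hd with rfl | hd
              · exact hci.ge
              · have := h4.1 d hd
                omega
            have hf : (c :: s).filter (fun b => decide (b.entry.val = i)) = [] :=
              List.filter_eq_nil_iff.2 fun d hd => by
                have := hall d hd
                simp; omega
            rw [e1]
            refine ⟨?_, ?_, fun e => ?_⟩
            · intro d hd
              rcases List.mem_cons.1 hd with rfl | hd
              · exact Or.inr hi'
              · exact h1 d hd
            · refine List.pairwise_cons.2 ⟨fun d hd => ?_, h2⟩
              have := hall d hd
              omega
            · rw [hprefix, List.filter_cons_of_neg (by simp [hi']), hf]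
              simp
      · rw [List.filter_cons_of_neg (by simp [hi, hi'])]
        refine ⟨h1, h2, fun e => ?_⟩
        rw [h3 e, List.map_cons, forall_prefix_cons]
        have e1 : ∀ q : List ℕ, (b.entry.val :: q).count i = q.count i := fun q =>
          List.count_cons_of_ne hi
        have e2 : ∀ q : List ℕ, (b.entry.val :: q).count (i + 1) = q.count (i + 1) := fun q =>
          List.count_cons_of_ne hi'
        simp only [e1, e2]
        simp

theorem lower_even_eq_none_iff (T : Filling n) {i : ℕ} (h : i + 1 < n) :
    lower (.even i h) T = none ↔
      ∀ q, q <+: readRows (valRows T) n → q.count i ≤ q.count (i + 1) := by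
  have hs := (reduced_spec i (reading T)).2.2 0
  simp only [map_entry_reading, Nat.add_zero] at hs
  rw [← hs, Nat.le_zero, List.length_eq_zero_iff]
  simp only [lower, Option.map_eq_none_iff, List.getLast?_eq_none_iff]
  rfl

/-- The odd operator imposes nothing new: if the first letter among `0` and `1` were `0`, the prefix
ending there would violate the ballot condition. -/
theorem isLowestWeight_iff (T : Filling n) :
    IsLowestWeight T ↔ ∀ i j : Fin n, i.val + 1 = j.val → ∀ q, q <+: readRows (valRows T) n →
      q.count i.val ≤ q.count j.val := by
  constructor
  · intro h i j hij
    have hi : i.val + 1 < n := by omega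
    have := (lower_even_eq_none_iff T hi).1 (h (.even i.val hi))
    rwa [hij] at this
  · intro h x
    cases x with
    | even i hi => exact (lower_even_eq_none_iff T hi).2 (h ⟨i, by omega⟩ ⟨i + 1, hi⟩ rfl)
    | odd hn =>
      have h01 := h ⟨0, by omega⟩ ⟨1, hn⟩ rfl
      simp only [lower]
      cases hp : readingPair 0 T with
      | nil => rfl
      | cons b L =>
        simp only [List.head?_cons, ite_eq_right_iff, reduceCtorEq, imp_false]
        intro hb
        obtain ⟨l₁, l₂, e, hl₁, -, -⟩ := List.filter_eq_cons_iff.1 hp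
        have hq : (l₁ ++ [b]).map (fun b => b.entry.val) <+: readRows (valRows T) n := by
          rw [← map_entry_reading, e]
          exact ⟨l₂.map (fun b => b.entry.val), by simp⟩
        have := h01 _ hq
        rw [List.map_append, List.count_append, List.count_append] at this
        have h1 : (l₁.map fun b => b.entry.val).count 1 = 0 := by
          refine List.count_eq_zero_of_not_mem fun hm => ?_
          obtain ⟨d, hd, hd1⟩ := List.mem_map.1 hm
          exact hl₁ d hd (by simp [hd1])
        rw [h1] at this
        simp [hb] at this

end LowestWeight

/-! ### Weights, formal exponentials and comparison of multiplicities -/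

section Weights

variable {n : ℕ}

/-- The standard basis vector `ε_i`, for `i` counted from `0`. -/
def basisVector (n i : ℕ) : Fin n → ℤ :=
  if h : i < n then Pi.single ⟨i, h⟩ 1 else 0

theorem basisVector_val (i : Fin n) : basisVector n i.val = Pi.single i 1 := by
  simp [basisVector]

/-- The weight of a family of row words. -/
def familyWeight (n : ℕ) : List (List ℕ) → Fin n → ℤ
  | [] => 0
  | w :: l => (w.map fun a => basisVector n a - basisVector n l.length).sum + familyWeight n l

theorem length_rowTails (R : ℕ → List ℕ) (k : ℕ) : (rowTails R k).length = k := by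
  induction k with
  | zero => rfl
  | succ k ih => simp [rowTails, ih]

/-- The leading `j`-boxes of row `j` have weight `ε_j - ε_j = 0`. -/
theorem familyWeight_rowTails {R : ℕ → List ℕ} {k : ℕ} (h : ∀ j < k, IsStandardRow R j) :
    familyWeight n (rowTails R k) = ∑ j ∈ Finset.range k,
      ((R j).map fun a => basisVector n a - basisVector n j).sum := by
  induction k with
  | zero => rfl
  | succ k ih =>
    rw [rowTails, familyWeight, ih fun j hj => h j (by omega), length_rowTails,
      Finset.sum_range_succ, add_comm]
    congr 1
    conv_rhs => rw [(h k (by omega)).eq_append]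
    simp

theorem sum_map_basisVector (L : List (Fin n)) (j a : Fin n) :
    ((L.map Fin.val).map fun b => basisVector n b - basisVector n j.val).sum a =
      (L.count a : ℤ) - if a = j then (L.length : ℤ) else 0 := by
  induction L with
  | nil => simp
  | cons b L ih =>
    rw [List.map_cons, List.map_cons, List.sum_cons, Pi.add_apply, ih, Pi.sub_apply,
      basisVector_val, basisVector_val, List.count_cons, List.length_cons, Pi.single_apply,
      Pi.single_apply]
    push_cast
    grind

theorem weight_eq_familyWeight {T : Filling n} (h : ∀ j < n, IsStandardRow (valRows T) j) :
    weight T = familyWeight n (rowTails (valRows T) n) := by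
  rw [familyWeight_rowTails h, Finset.sum_range]
  funext a
  rw [Finset.sum_apply]
  simp only [valRows_val, sum_map_basisVector]
  rw [Finset.sum_sub_distrib, Finset.sum_ite_eq, if_pos (Finset.mem_univ a)]
  rfl

/-- The formal exponentials, in the fraction field of the group algebra of `ℤⁿ`. -/
noncomputable def expo (v : Fin n → ℤ) : FractionRing (AddMonoidAlgebra ℤ (Fin n → ℤ)) :=
  algebraMap (AddMonoidAlgebra ℤ (Fin n → ℤ)) _ (AddMonoidAlgebra.single v 1)

theorem expo_zero : expo (0 : Fin n → ℤ) = 1 := by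
  rw [expo, ← AddMonoidAlgebra.one_def, map_one]

theorem expo_add (v w : Fin n → ℤ) : expo (v + w) = expo v * expo w := by
  rw [expo, expo, expo, ← map_mul, AddMonoidAlgebra.single_mul_single, one_mul]

theorem expo_ne_zero (v : Fin n → ℤ) : expo v ≠ 0 := by
  intro h
  have := expo_add v (-v)
  rw [h, zero_mul, add_neg_cancel, expo_zero] at this
  exact one_ne_zero this

theorem expo_sub (v w : Fin n → ℤ) : expo (v - w) = expo v / expo w := by
  rw [eq_div_iff (expo_ne_zero w), ← expo_add, sub_add_cancel]

theorem expo_sum {ι : Type*} (s : Finset ι) (f : ι → Fin n → ℤ) :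
    expo (∑ i ∈ s, f i) = ∏ i ∈ s, expo (f i) := by
  classical
  induction s using Finset.induction_on with
  | empty => simp [expo_zero]
  | insert a s ha ih => rw [Finset.sum_insert ha, Finset.prod_insert ha, expo_add, ih]

theorem expo_list_sum (L : List (Fin n → ℤ)) : expo L.sum = (L.map expo).prod := by
  induction L with
  | nil => simp [expo_zero]
  | cons a L ih => rw [List.sum_cons, List.map_cons, List.prod_cons, expo_add, ih]

theorem expo_injective : Function.Injective (expo (n := n)) := by
  intro v w h
  have h1 := IsFractionRing.injective (AddMonoidAlgebra ℤ (Fin n → ℤ))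
    (FractionRing (AddMonoidAlgebra ℤ (Fin n → ℤ))) h
  exact AddMonoidAlgebra.single_left_injective one_ne_zero h1

theorem prod_pow_count {K : Type*} [Field K] (x : ℕ → K) {k : ℕ} (hk : x k ≠ 0) {w : List ℕ}
    (hw : ∀ a ∈ w, a ≤ k) :
    ∏ i : Fin k, (x i / x k) ^ w.count i.val = (w.map fun a => x a / x k).prod := by
  induction w with
  | nil => simp
  | cons a w ih =>
    rw [List.map_cons, List.prod_cons, ← ih fun b hb => hw b (by simp [hb])]
    rcases Nat.lt_or_eq_of_le (hw a (by simp)) with ha | rfl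
    · have : ∀ i : Fin k, (x i / x k) ^ (a :: w).count i.val =
          (if i = ⟨a, ha⟩ then x i / x k else 1) * (x i / x k) ^ w.count i.val := fun i => by
        rw [List.count_cons]
        by_cases h : i = ⟨a, ha⟩
        · subst h
          simp [pow_succ, mul_comm]
        · have h' : a ≠ i.val := fun e => h (Fin.ext e.symm)
          simp [h, h']
      simp only [this]
      rw [Finset.prod_mul_distrib, Finset.prod_ite_eq', if_pos (Finset.mem_univ _)]
    · rw [div_self hk, one_mul]
      refine Finset.prod_congr rfl fun i _ => ?_
      rw [List.count_cons_of_ne i.2.ne']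

theorem IsRowWord.le_of_mem {k : ℕ} {c : Fin (k + 1) → ℕ} {w : List ℕ} (h : IsRowWord k c w)
    {a : ℕ} (ha : a ∈ w) : a ≤ k := by
  obtain ⟨v, u, rfl, hs, -⟩ := h
  rcases List.mem_append.1 ha with ha | ha
  · exact (hs.left_lt a ha).le
  · exact hs.right_le a ha

theorem expo_familyWeight {k : ℕ} {c : Fin k → ℕ} {l : List (List ℕ)} (h : IsFamily k c l) :
    expo (familyWeight n l) = familyMonomial (fun i => expo (basisVector n i)) l := by
  induction k generalizing l with
  | zero => simp [show l = [] from h, familyWeight, familyMonomial, expo_zero]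
  | succ k ih =>
    obtain ⟨w, l, rfl, hw, hl⟩ := h
    have hlen := hl.length_eq
    rw [familyWeight, familyMonomial, expo_add, ih hl,
      prod_pow_count (fun i => expo (basisVector n i)) (expo_ne_zero _)
        (fun a ha => hlen ▸ hw.le_of_mem ha)]
    rw [expo_list_sum, List.map_map]
    congr 3
    funext a
    exact expo_sub _ _

theorem sum_powerset_expo (n : ℕ) :
    ∑ B ∈ (positiveRoots n).powerset, expo (∑ β ∈ B, β) =
      ∏ j ∈ Finset.range n, ∏ i : Fin j,
        (1 + expo (basisVector n i) / expo (basisVector n j)) := by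
  classical
  have h1 : ∑ B ∈ (positiveRoots n).powerset, expo (∑ β ∈ B, β) =
      ∏ β ∈ positiveRoots n, (1 + expo β) := by
    rw [Finset.prod_one_add]
    exact Finset.sum_congr rfl fun B _ => expo_sum _ _
  rw [h1, positiveRoots, Finset.prod_image, Finset.prod_filter, ← Finset.univ_product_univ,
    Finset.prod_product_right, Finset.prod_range]
  · refine Finset.prod_congr rfl fun j _ => ?_
    rw [← Finset.prod_filter]
    symm
    refine Finset.prod_bij (fun (i : Fin j) _ => (⟨i.val, i.2.trans j.2⟩ : Fin n)) ?_ ?_ ?_ ?_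
    · intro i _
      exact Finset.mem_filter.2 ⟨Finset.mem_univ _, i.2⟩
    · intro i _ i' _ h
      simpa [Fin.ext_iff] using h
    · intro i hi
      exact ⟨⟨i.val, (Finset.mem_filter.1 hi).2⟩, Finset.mem_univ _, rfl⟩
    · intro i _
      rw [expo_sub, basisVector_val, ← basisVector_val (⟨i.val, i.2.trans j.2⟩ : Fin n)]
  · rintro ⟨i, j⟩ hij ⟨i', j'⟩ hij' h
    simp only [Finset.coe_filter, Finset.mem_univ, true_and, Set.mem_ofPred_eq] at hij hij' h
    have e1 := congrFun h i
    have e2 := congrFun h j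
    simp only [Pi.sub_apply, Pi.single_apply] at e1 e2
    grind

/-- The comparison takes place in the fraction field because the product formula was obtained by
cancelling a Vandermonde determinant; injectivity of the localization map brings it back to the
group algebra. -/
theorem sum_single_families (n : ℕ) :
    ∑ l ∈ families n 0, AddMonoidAlgebra.single (familyWeight n l) (1 : ℤ) =
      ∑ B ∈ (positiveRoots n).powerset, AddMonoidAlgebra.single (∑ β ∈ B, β) (1 : ℤ) := by
  apply IsFractionRing.injective (AddMonoidAlgebra ℤ (Fin n → ℤ))
    (FractionRing (AddMonoidAlgebra ℤ (Fin n → ℤ)))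
  rw [map_sum, map_sum]
  refine Eq.trans ?_ (sum_powerset_expo n).symm
  -- For `i ≥ n` the vector `basisVector n i` is `0` and its exponential is `1`, so all variables
  -- are nonzero; distinctness is needed only for indices below `n`.
  rw [← sum_families_zero (fun i => expo (basisVector n i)) (fun i => expo_ne_zero _)]
  · exact Finset.sum_congr rfl fun l hl => expo_familyWeight (mem_families.1 hl)
  · intro i hi j hj h
    have h := expo_injective h
    have h := congrFun h ⟨i, hi⟩
    simp only [basisVector, dif_pos hi, dif_pos hj, Pi.single_eq_same, Pi.single_apply] at h
    simpa [Fin.ext_iff] using h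

/-- Integer coefficients have characteristic zero, so the coefficient of each exponential counts the
elements of that weight. -/
theorem card_filter_families (n : ℕ) (v : Fin n → ℤ) :
    #((families n 0).filter fun l => familyWeight n l = v) =
      #((positiveRoots n).powerset.filter fun B => ∑ β ∈ B, β = v) := by
  have h := congrArg (fun f : AddMonoidAlgebra ℤ (Fin n → ℤ) => f.coeff v)
    (sum_single_families n)
  simp only [AddMonoidAlgebra.coeff_sum, AddMonoidAlgebra.coeff_single, Finsupp.finsetSum_apply,
    Finsupp.single_apply, Finset.sum_boole] at h
  exact_mod_cast h

/-- A weight preserving bijection exists as soon as all weight multiplicities agree. -/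
theorem exists_equiv_of_card_filter_eq {α β γ : Type*} [DecidableEq γ] (s : Finset α)
    (t : Finset β) (f : α → γ) (g : β → γ)
    (h : ∀ v, #(s.filter fun a => f a = v) = #(t.filter fun b => g b = v)) :
    ∃ e : {a // a ∈ s} ≃ {b // b ∈ t}, ∀ a, g (e a) = f a := by
  have key : ∀ v, Nonempty ({a : {a // a ∈ s} // f a = v} ≃ {b : {b // b ∈ t} // g b = v}) := by
    intro v
    refine ⟨((Equiv.subtypeSubtypeEquivSubtypeInter (· ∈ s) (fun a => f a = v)).trans ?_).trans
      (Equiv.subtypeSubtypeEquivSubtypeInter (· ∈ t) (fun b => g b = v)).symm⟩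
    refine ((Equiv.subtypeEquivRight fun a => ?_).trans (Finset.equivOfCardEq (h v))).trans
      (Equiv.subtypeEquivRight fun b => ?_)
    · simp
    · simp
  exact ⟨Equiv.ofFiberEquiv fun v => (key v).some, fun a => Equiv.ofFiberEquiv_map
    (f := fun a : {a // a ∈ s} => f a) (g := fun b : {b // b ∈ t} => g b) _ a⟩

end Weights

/-- The row tails of a lowest weight tableau. -/
theorem exists_equiv_families (n : ℕ) :
    ∃ e : {T : SDTInf n // IsLowestWeight T.val} ≃ {l // l ∈ families n 0},
      ∀ T, familyWeight n (e T).val = weight T.val.val := by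
  have hstd : ∀ T : SDTInf n, ∀ j < n, IsStandardRow (valRows T.val) j := fun T =>
    isStandardRow_of_isSDT T.2.1 T.2.2
  have hfam : ∀ T : SDTInf n, IsLowestWeight T.val ↔
      rowTails (valRows T.val) n ∈ families n 0 := fun T => by
    rw [isLowestWeight_iff, mem_families,
      ← ballot_readRows_iff (hstd T) (c := 0) (fun _ _ _ => le_rfl)]
    simp
  refine ⟨Equiv.ofBijective (fun T => ⟨rowTails (valRows T.val.val) n, (hfam T.val).1 T.2⟩)
    ⟨?_, ?_⟩, fun T => (weight_eq_familyWeight (hstd T.val)).symm⟩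
  · intro T T' h
    exact Subtype.ext (Subtype.ext (valRows_injective
      (eq_of_rowTails_eq (hstd T.val) (hstd T'.val) (congrArg Subtype.val h))))
  · rintro ⟨l, hl⟩
    obtain ⟨R, hR, rfl⟩ := exists_rows_of_isFamily (mem_families.1 hl)
    obtain ⟨T, hT⟩ := exists_filling hR
    have hT' : ∀ j < n, IsStandardRow (valRows T) j := fun j hj =>
      isStandardRow_congr (fun i hi => (hT i (by omega)).symm) (hR j hj)
    have e : rowTails (valRows T) n = rowTails R n := rowTails_congr hT
    let T' : SDTInf n :=
      ⟨T, isSDT_of_isStandardRow hT', isDualMarginallyLarge_of_isStandardRow hT'⟩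
    exact ⟨⟨T', (hfam T').2 (by rw [e]; exact hl)⟩, Subtype.ext e⟩

end QueerCrystal

theorem mainTheorem3 (n : ℕ) :
    ∃ Ξ : {B : Finset (Fin n → ℤ) // B ⊆ QueerCrystal.positiveRoots n} →
        {T : QueerCrystal.SDTInf n // QueerCrystal.IsLowestWeight T.val},
      Function.Bijective Ξ ∧
        ∀ B, QueerCrystal.weight (Ξ B).val.val = ∑ β ∈ B.val, β := by
  obtain ⟨e, he⟩ := QueerCrystal.exists_equiv_families n
  obtain ⟨e', he'⟩ := QueerCrystal.exists_equiv_of_card_filter_eq _ _ _ _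
    fun v => (QueerCrystal.card_filter_families n v).symm
  let e'' : {B : Finset (Fin n → ℤ) // B ⊆ QueerCrystal.positiveRoots n} ≃
      {B // B ∈ (QueerCrystal.positiveRoots n).powerset} :=
    Equiv.subtypeEquivRight fun B => Finset.mem_powerset.symm
  refine ⟨(e''.trans e').trans e.symm, Equiv.bijective _, fun B => ?_⟩
  rw [← he]
  simp only [Equiv.trans_apply, Equiv.apply_symm_apply]
  exact he' (e'' B)
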